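/- Let $n\ge 1$ and let $K\subset\mathbb{R}^n$ be a convex body of class $C^2_+$: a compact convex set with non-empty interior whose boundary is of class $C^2$ and whose Gauss map $\nu:\partial K\to S^{n-1}$ (outward unit normal) is a $C^1$ diffeomorphism. For $0\le j\le n-1$ let $H_j=\binom{n-1}{j}^{-1}\sum_{i_1<\dots<i_j}k_{i_1}\cdots k_{i_j}$ be the $j$-th normalized elementary symmetric function of the principal curvatures $k_1,\dots,k_{n-1}$ of $\partial K$, the eigenvalues of the differential of $\nu$ ($H_0=1$, and $H_{n-1}$ is the Gauss curvature). The classical quermassintegrals of $K$ are $$W_0(K)=\mathrm{vol}_n(K),\qquad W_i(K)=\frac1n\int_{\partial K}H_{i-1}\,d\mathcal{H}^{n-1}\quad(1\le i\le n).$$ For real $p\ne -n$ the $L_p$ affine surface area of a convex body $L$ with sufficiently smooth boundary is $$as_p(L)=\int_{\partial L}\frac{H_{n-1}(x)^{\frac{p}{n+p}}}{\langle x,\nu(x)\rangle^{\frac{n(p-1)}{n+p}}}\,d\mathcal{H}^{n-1}(x),$$ so that $as_0(L)=\int_{\partial L}\langle x,\nu(x)\rangle\,d\mathcal{H}^{n-1}(x)$.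 Let $B^n_2$ be the closed Euclidean unit ball. Then for every real $t\ge 0$ $$as_0(K+tB^n_2)=n\,\mathrm{vol}_n(K+tB^n_2)=n\sum_{i=0}^n\binom ni W_i(K)\,t^i .$$ -/

import Mathlib

open Set MeasureTheory
open scoped Pointwise RealInnerProductSpace

noncomputable section

namespace Steiner

/-- `n`-dimensional Euclidean space. -/
abbrev Euc (n : ℕ) : Type := EuclideanSpace ℝ (Fin n)

variable {n : ℕ}

/-- `u` is an outward unit normal vector of `K` at the point `x`. -/
def IsOuterUnitNormal (K : Set (Euc n)) (x u : Euc n) : Prop :=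
  ‖u‖ = 1 ∧ ∀ y ∈ K, ⟪u, y - x⟫ ≤ 0

open Classical in
/-- The Gauss map `ν`. At a boundary point of a convex body of class `C²`, the outward unit normal
exists and is unique. The value is `0` if there is no outward unit normal. -/
def gaussMap (K : Set (Euc n)) (x : Euc n) : Euc n :=
  if h : ∃ u, IsOuterUnitNormal K x u then h.choose else 0

/-- `K` is of class `C²`: near each of its boundary points, `K` is the sublevel set of a `C²`
function with non-vanishing differential. In particular `K` has interior points near each of its
boundary points, and the boundary is an embedded `C²` hypersurface. -/
def IsClassC2 (K : Set (Euc n)) : Prop :=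
  ∀ x ∈ frontier K, ∃ U : Set (Euc n), IsOpen U ∧ x ∈ U ∧ ∃ φ : Euc n → ℝ,
    ContDiffOn ℝ 2 φ U ∧ fderiv ℝ φ x ≠ 0 ∧ K ∩ U = {y ∈ U | φ y ≤ 0}

/-- `K` is of class `C²₊`: it is of class `C²`, and its Gauss map is a `C¹` diffeomorphism of the
boundary onto the unit sphere, with inverse `ξ` (the reverse Gauss map). For maps on a `C¹`
hypersurface of Euclidean space, `ContDiffOn ℝ 1` is continuous differentiability
along the hypersurface. -/
structure IsClassC2Plus (K : Set (Euc n)) : Prop where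
  classC2 : IsClassC2 K
  mapsTo : MapsTo (gaussMap K) (frontier K) (Metric.sphere 0 1)
  contDiffOn : ContDiffOn ℝ 1 (gaussMap K) (frontier K)
  exists_inverse : ∃ ξ : Euc n → Euc n, MapsTo ξ (Metric.sphere 0 1) (frontier K) ∧
    ContDiffOn ℝ 1 ξ (Metric.sphere 0 1) ∧ InvOn ξ (gaussMap K) (frontier K) (Metric.sphere 0 1)

/-- The Weingarten map at the boundary point `x`: the differential of the Gauss map on the tangent
space of the boundary, which is the orthogonal complement of `ν x`. Here `fderivWithin` is some
derivative of `ν` within the boundary. Only its restriction to the tangent space is used, and this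
restriction does not depend on the choice. It takes values in the tangent space, so that the
orthogonal projection only adjusts the codomain. -/
def weingarten (K : Set (Euc n)) (x : Euc n) :
    (ℝ ∙ gaussMap K x)ᗮ →ₗ[ℝ] (ℝ ∙ gaussMap K x)ᗮ :=
  ((ℝ ∙ gaussMap K x)ᗮ.orthogonalProjectionOnto ∘L
    fderivWithin ℝ (gaussMap K) (frontier K) x ∘L (ℝ ∙ gaussMap K x)ᗮ.subtypeL).toLinearMap

/-- The principal curvatures of `K` at the boundary point `x`: the eigenvalues of the Weingarten
map, with multiplicity. -/
def principalCurvatures (K : Set (Euc n)) (x : Euc n) : Multiset ℝ :=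
  (weingarten K x).charpoly.roots

/-- The `j`-th normalized elementary symmetric function `H_j` of the principal curvatures.
For `j = 0` it is `1`, and for `j = n - 1` it is the Gauss curvature. -/
def normalizedCurvature (K : Set (Euc n)) (j : ℕ) (x : Euc n) : ℝ :=
  ((n - 1).choose j : ℝ)⁻¹ * (principalCurvatures K x).esymm j

/-- The `L_p` affine surface area of `K`, for `p ≠ -n`. The measure `μHE[n - 1]` is the
`(n - 1)`-dimensional Hausdorff measure, normalized so that it is the surface area. -/
def affineSurfaceArea (p : ℝ) (K : Set (Euc n)) : ℝ :=
  ∫ x in frontier K, normalizedCurvature K (n - 1) x ^ (p / (n + p)) /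
    ⟪x, gaussMap K x⟫ ^ (n * (p - 1) / (n + p)) ∂μHE[n - 1]

/-- The classical quermassintegrals `W_i` of a convex body of class `C²₊`, for `0 ≤ i ≤ n`. -/
def quermassintegral (K : Set (Euc n)) : ℕ → ℝ
  | 0 => volume.real K
  | i + 1 => 1 / n * ∫ x in frontier K, normalizedCurvature K i x ∂μHE[n - 1]

end Steiner

end

/-! Write `L = K + t B`. For `p = 0` the curvature has exponent `0` and the support factor exponent
`-1`, so `as_0(L)` is the integral of `⟪y, ν y⟫` over the boundary. Two volume computations remain,
each parametrizing a body by its boundary times an interval.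

Cones: for an interior point `c`, the map `(y, s) ↦ c + s (y - c)`, `0 < s ≤ 1`, covers `L \ {c}`
injectively with Jacobian `s ^ (n - 1) * ⟪y - c, ν y⟫`, which gives `n * vol L = ∫ ⟪y - c, ν y⟫`
(`integral_inner_sub_normal`). Varying `c` removes it (`integral_inner_normal`). Only a continuous
normal field on the boundary is needed; for `L` it is the normal of `K` transported along `x ↦ x + t
ν x`, whose inverse is `1`-Lipschitz (`continuousOn_gaussMap_parallel`).

Tubes: the map `(x, s) ↦ x + s ν x`, `0 < s ≤ t`, covers `L \ K` injectively with Jacobian `det (1 +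
s W)`, where `W` is the Weingarten map. Since `W` is symmetric and positive, this is the nonnegative
polynomial `∑ s ^ j e_j` in the principal curvatures; integrating in `s` yields Steiner's formula
(`volume_parallel`).

Both rest on one area formula, `volume_image_eq_lintegral`. Near a point, the hypersurface is
compared with its tangent hyperplane by orthogonal projection, and the map becomes approximately
linear on a slab of `ℝⁿ`; compactness and additivity globalize the estimate. The properties of `W`
come from its inverse, the differential of the reverse Gauss map, which is the Hessian of the
support function. -/

noncomputable section
namespace Steiner
open Filter Topology Module
open scoped ENNReal NNReal

/-! ### Slabs over a hyperplane and Hausdorff measure under orthogonal projection -/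

section Slab

variable {n : ℕ}

theorem finrank_orthogonal_span {u : Euc n} (hu : ‖u‖ = 1) :
    finrank ℝ (ℝ ∙ u)ᗮ = n - 1 := by
  have hu0 : u ≠ 0 := by rintro rfl; simp at hu
  have h := (ℝ ∙ u).finrank_add_finrank_orthogonal
  rw [finrank_span_singleton hu0, finrank_euclideanSpace_fin] at h
  omega

/-- The projection onto the hyperplane orthogonal to `u`. -/
abbrev orthProj (u : Euc n) : Euc n →L[ℝ] (ℝ ∙ u)ᗮ := (ℝ ∙ u)ᗮ.orthogonalProjectionOnto

theorem orthProj_add_smul {u : Euc n} (hu : ‖u‖ = 1) (z : Euc n) :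
    (orthProj u z : Euc n) + ⟪u, z⟫ • u = z := by
  have h1 : ((ℝ ∙ u).starProjection z : Euc n) = ⟪u, z⟫ • u :=
    Submodule.starProjection_unit_singleton ℝ hu z
  have h := Submodule.starProjection_add_starProjection_orthogonal (K := ℝ ∙ u) z
  rw [h1] at h
  rw [add_comm]
  exact h

theorem norm_orthProj_le (u z : Euc n) : ‖orthProj u z‖ ≤ ‖z‖ :=
  Submodule.norm_orthogonalProjectionOnto_apply_le _ z

theorem volume_slab {u : Euc n} (hu : ‖u‖ = 1) (B : Set (ℝ ∙ u)ᗮ) (I : Set ℝ) :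
    volume {z : Euc n | ⟪u, z⟫ ∈ I ∧ orthProj u z ∈ B} = volume I * volume B := by
  let e := LinearIsometryEquiv.toSpanUnitSingleton (𝕜 := ℝ) u hu
  have hmp := (ℝ ∙ u).measurePreserving_measurableEquivProd (0 : Euc n)
  have hvol : (μHE[finrank ℝ (Euc n)] : Measure (Euc n)) = volume :=
    InnerProductSpace.euclideanHausdorffMeasure_eq_volume
  rw [hvol] at hmp
  have hset : {z : Euc n | ⟪u, z⟫ ∈ I ∧ orthProj u z ∈ B} =
      ((ℝ ∙ u).measurableEquivProd (0 : Euc n)) ⁻¹' ((e.symm ⁻¹' I) ×ˢ B) := by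
    ext z
    have : e.symm ((ℝ ∙ u).orthogonalProjectionOnto z) = ⟪u, z⟫ := by
      rw [LinearIsometryEquiv.symm_apply_eq]
      ext1
      simpa [e] using Submodule.starProjection_unit_singleton ℝ hu z
    simp [this]
  rw [hset, hmp.measure_preimage_equiv, Measure.volume_eq_prod, Measure.prod_prod]
  congr 1
  have := (e.symm.measurePreserving).measure_preimage_equiv (f := e.symm.toMeasurableEquiv) I
  exact this

theorem euclideanHausdorffMeasure_orthProj {u : Euc n} (hu : ‖u‖ = 1) (B : Set (ℝ ∙ u)ᗮ) :
    μHE[n - 1] B = volume B := by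
  rw [← InnerProductSpace.euclideanHausdorffMeasure_eq_volume, finrank_orthogonal_span hu]

theorem euclideanHausdorffMeasure_image_le {X Y : Type*} [MetricSpace X] [MeasurableSpace X]
    [BorelSpace X] [MetricSpace Y] [MeasurableSpace Y] [BorelSpace Y] {L : ℝ≥0} {f : X → Y}
    {s : Set X} (hf : LipschitzOnWith L f s) (d : ℕ) :
    μHE[d] (f '' s) ≤ (L : ℝ≥0∞) ^ d * μHE[d] s := by
  have h := hf.hausdorffMeasure_image_le (d := (d : ℝ)) (by positivity)
  simp only [Measure.euclideanHausdorffMeasure_def, Measure.smul_apply, ENNReal.smul_def,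
    smul_eq_mul]
  rw [ENNReal.rpow_natCast] at h
  calc _ ≤ _ := mul_le_mul_right h _
    _ = _ := by ring

theorem euclideanHausdorffMeasure_orthProj_image_le {u : Euc n} (hu : ‖u‖ = 1)
    (A : Set (Euc n)) : volume (orthProj u '' A) ≤ μHE[n - 1] A := by
  have hf : LipschitzOnWith 1 (orthProj u) A := by
    refine LipschitzOnWith.of_dist_le_mul fun x _ y _ => ?_
    rw [dist_eq_norm, dist_eq_norm, ← map_sub, NNReal.coe_one, one_mul]
    exact norm_orthProj_le u _
  have := euclideanHausdorffMeasure_image_le hf (n - 1)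
  rw [← euclideanHausdorffMeasure_orthProj hu]
  simpa using this

/-- On such a set the projection has an `L`-Lipschitz inverse. -/
theorem euclideanHausdorffMeasure_le_orthProj_image {u : Euc n} (hu : ‖u‖ = 1)
    {A : Set (Euc n)} {L : ℝ≥0}
    (hA : ∀ x ∈ A, ∀ y ∈ A, ‖x - y‖ ≤ L * ‖orthProj u (x - y)‖) :
    μHE[n - 1] A ≤ (L : ℝ≥0∞) ^ (n - 1) * volume (orthProj u '' A) := by
  have hinj : InjOn (orthProj u) A := by
    intro x hx y hy hxy
    have := hA x hx y hy
    rw [map_sub, hxy, sub_self, norm_zero, mul_zero] at this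
    exact sub_eq_zero.1 (norm_le_zero_iff.1 this)
  let g := Function.invFunOn (orthProj u) A
  have hg : ∀ x ∈ A, g (orthProj u x) = x := fun x hx => hinj.leftInvOn_invFunOn hx
  have hgL : LipschitzOnWith L g (orthProj u '' A) := by
    refine LipschitzOnWith.of_dist_le_mul ?_
    rintro _ ⟨x, hx, rfl⟩ _ ⟨y, hy, rfl⟩
    rw [hg x hx, hg y hy, dist_eq_norm, dist_eq_norm, ← map_sub]
    exact hA x hx y hy
  have him : g '' (orthProj u '' A) = A := by
    ext z
    constructor
    · rintro ⟨_, ⟨x, hx, rfl⟩, rfl⟩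
      rwa [hg x hx]
    · intro hz
      exact ⟨_, ⟨z, hz, rfl⟩, hg z hz⟩
  have := euclideanHausdorffMeasure_image_le hgL (n - 1)
  rwa [him, euclideanHausdorffMeasure_orthProj hu] at this

end Slab

/-! ### Local volume estimates by flattening the hypersurface -/

section Local

variable {n : ℕ}

/-- `M` has the tangent hyperplane `uᗮ` at `a`, in the strict sense. -/
def StrictTangent (M : Set (Euc n)) (u a : Euc n) : Prop :=
  (fun p : Euc n × Euc n => ⟪u, p.1 - p.2⟫) =o[𝓝[M] a ×ˢ 𝓝[M] a] (fun p => p.1 - p.2)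

/-- The map `Φ` on `M × I` has at `z` the strict derivative `(w, r) ↦ D (w + r u)`. -/
def StrictDeriv (M : Set (Euc n)) (I : Set ℝ) (Φ : Euc n × ℝ → Euc n) (u : Euc n)
    (D : Euc n →L[ℝ] Euc n) (z : Euc n × ℝ) : Prop :=
  (fun p : (Euc n × ℝ) × (Euc n × ℝ) =>
    Φ p.1 - Φ p.2 - D (p.1.1 - p.2.1 + (p.1.2 - p.2.2) • u))
      =o[𝓝[M ×ˢ I] z ×ˢ 𝓝[M ×ˢ I] z] (fun p => p.1 - p.2)

theorem StrictTangent.eventually_norm_le {M : Set (Euc n)} {u a : Euc n} (hu : ‖u‖ = 1)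
    (h : StrictTangent M u a) {L : ℝ≥0} (hL : 1 < L) :
    ∃ U ∈ 𝓝[M] a, ∀ x ∈ U, ∀ y ∈ U, ‖x - y‖ ≤ L * ‖orthProj u (x - y)‖ := by
  have hL0 : (0 : ℝ) < L := by exact_mod_cast zero_lt_one.trans hL
  have hL1 : (1 : ℝ) < L := by exact_mod_cast hL
  -- If the normal part is at most `(1 - 1/L) ‖x - y‖`, the tangential part is at least `‖x - y‖ /
  -- L`.
  have hε : (0 : ℝ) < 1 - (L : ℝ)⁻¹ := sub_pos.2 (inv_lt_one_of_one_lt₀ hL1)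
  obtain ⟨U, hU, hUU⟩ := eventually_prod_self_iff'.1 (h.def hε)
  refine ⟨U, hU, fun x hx y hy => ?_⟩
  have h1 := hUU x hx y hy
  have h2 : ‖x - y‖ ≤ ‖orthProj u (x - y)‖ + ‖⟪u, x - y⟫‖ := by
    conv_lhs => rw [← orthProj_add_smul hu (x - y)]
    refine (norm_add_le _ _).trans ?_
    rw [norm_smul, hu, mul_one, Submodule.coe_norm]
  have h3 : (L : ℝ)⁻¹ * ‖x - y‖ ≤ ‖orthProj u (x - y)‖ := by
    simp only at h1
    linarith
  rwa [inv_mul_le_iff₀ hL0] at h3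

/-- Lifting the slab back to `A × I` inverts the projection on `A`. The increment `x - x' + (s - s')
u` differs from `z - z'` only by the normal part of `x - x'`, which tangency makes negligible. This
reduces the problem to linear approximation in `ℝⁿ`. -/
theorem exists_approximatesLinearOn_slab {M : Set (Euc n)} {I₀ : Set ℝ}
    {Φ : Euc n × ℝ → Euc n} {u a : Euc n} {s₀ : ℝ} {D : Euc n →L[ℝ] Euc n} (hu : ‖u‖ = 1)
    (hT : StrictTangent M u a) (hD : StrictDeriv M I₀ Φ u D (a, s₀)) {δ : ℝ≥0} (hδ : 0 < δ) :
    ∃ U ∈ 𝓝[M] a, ∃ V ∈ 𝓝[I₀] s₀, ∀ A ⊆ U, ∀ I ⊆ V, ∃ F : Euc n → Euc n,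
      ApproximatesLinearOn F D {z | ⟪u, z⟫ ∈ I ∧ orthProj u z ∈ orthProj u '' A} δ ∧
      F '' {z | ⟪u, z⟫ ∈ I ∧ orthProj u z ∈ orthProj u '' A} = Φ '' (A ×ˢ I) := by
  obtain ⟨U₁, hU₁, hU₁'⟩ := hT.eventually_norm_le hu (L := 2) (by norm_num)
  -- The increments in `M × I` are at most `2 ‖z - z'‖`, so the normal error contributes `δ / 2` and
  -- the derivative error `2 * (δ / 4)`. The `+ 1` covers `D = 0`.
  have hc : (0 : ℝ) < δ / (4 * (‖D‖ + 1)) := by positivity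
  obtain ⟨U₂, hU₂, hU₂'⟩ := eventually_prod_self_iff'.1 (hT.def hc)
  have hc' : (0 : ℝ) < δ / 4 := by positivity
  obtain ⟨W, hW, hW'⟩ := eventually_prod_self_iff'.1 (hD.def hc')
  rw [nhdsWithin_prod_eq] at hW
  obtain ⟨U₃, hU₃, V, hV, hUV⟩ := mem_prod_iff.1 hW
  refine ⟨U₁ ∩ U₂ ∩ U₃, inter_mem (inter_mem hU₁ hU₂) hU₃, V, hV, fun A hA I hI => ?_⟩
  have hinj : InjOn (orthProj u) A := by
    intro x hx y hy hxy
    have := hU₁' x (hA hx).1.1 y (hA hy).1.1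
    rw [map_sub, hxy, sub_self, norm_zero, mul_zero] at this
    exact sub_eq_zero.1 (norm_le_zero_iff.1 this)
  let g := Function.invFunOn (orthProj u) A
  have hg : ∀ x ∈ A, g (orthProj u x) = x := fun x hx => hinj.leftInvOn_invFunOn hx
  refine ⟨fun z => Φ (g (orthProj u z), ⟪u, z⟫), ?_, ?_⟩
  · rintro z ⟨hz, x, hx, hxz⟩ z' ⟨hz', x', hx', hxz'⟩
    simp only [← hxz, ← hxz', hg x hx, hg x' hx']
    have h1 := hW' (x, ⟪u, z⟫) (hUV ⟨(hA hx).2, hI hz⟩) (x', ⟪u, z'⟫) (hUV ⟨(hA hx').2, hI hz'⟩)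
    have h2 := hU₂' x (hA hx).1.2 x' (hA hx').1.2
    have h3 := hU₁' x (hA hx).1.1 x' (hA hx').1.1
    simp only at h1 h2
    have hpz : orthProj u (x - x') = orthProj u (z - z') := by rw [map_sub, map_sub, hxz, hxz']
    rw [hpz] at h3
    have h4 : ‖x - x'‖ ≤ 2 * ‖z - z'‖ := by
      refine h3.trans ?_
      have := norm_orthProj_le u (z - z')
      push_cast
      linarith
    have h5 : ‖((x, ⟪u, z⟫) : Euc n × ℝ) - (x', ⟪u, z'⟫)‖ ≤ 2 * ‖z - z'‖ := by
      rw [Prod.mk_sub_mk, Prod.norm_mk, ← inner_sub_right]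
      refine max_le h4 ?_
      have := norm_inner_le_norm (𝕜 := ℝ) u (z - z')
      rw [hu, one_mul] at this
      have := norm_nonneg (z - z')
      linarith
    have h6 : x - x' + (⟪u, z⟫ - ⟪u, z'⟫) • u = (z - z') + ⟪u, x - x'⟫ • u := by
      have e1 := orthProj_add_smul hu (x - x')
      have e2 := orthProj_add_smul hu (z - z')
      rw [hpz] at e1
      conv_lhs => rw [← e1]
      conv_rhs => rw [← e2]
      rw [inner_sub_right u z z']
      abel
    rw [h6, map_add] at h1
    have h7 : ‖D (⟪u, x - x'⟫ • u)‖ ≤ δ / 2 * ‖z - z'‖ := by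
      calc ‖D (⟪u, x - x'⟫ • u)‖ ≤ ‖D‖ * ‖⟪u, x - x'⟫ • u‖ := D.le_opNorm _
        _ = ‖D‖ * ‖⟪u, x - x'⟫‖ := by rw [norm_smul, hu, mul_one]
        _ ≤ (‖D‖ + 1) * (δ / (4 * (‖D‖ + 1)) * (2 * ‖z - z'‖)) := by
            gcongr
            · linarith
            · exact h2.trans (by gcongr)
        _ = δ / 2 * ‖z - z'‖ := by field_simp; ring
    have h8 := h1.trans (mul_le_mul_of_nonneg_left h5 hc'.le)
    calc _ = ‖(Φ (x, ⟪u, z⟫) - Φ (x', ⟪u, z'⟫) - (D (z - z') + D (⟪u, x - x'⟫ • u)))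
            + D (⟪u, x - x'⟫ • u)‖ := by congr 1; abel
      _ ≤ _ := norm_add_le _ _
      _ ≤ δ / 4 * (2 * ‖z - z'‖) + δ / 2 * ‖z - z'‖ := add_le_add h8 h7
      _ = δ * ‖z - z'‖ := by ring
  · ext y
    constructor
    · rintro ⟨z, ⟨hz, x, hx, hxz⟩, rfl⟩
      refine ⟨(x, ⟪u, z⟫), ⟨hx, hz⟩, ?_⟩
      simp only [← hxz, hg x hx]
    · rintro ⟨⟨x, s⟩, ⟨hx, hs⟩, rfl⟩
      have huu : ⟪u, u⟫ = 1 := by rw [real_inner_self_eq_norm_sq, hu, one_pow]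
      have e1 : ⟪u, x + (s - ⟪u, x⟫) • u⟫ = s := by
        rw [inner_add_right, inner_smul_right, huu]; ring
      have e2 : orthProj u (x + (s - ⟪u, x⟫) • u) = orthProj u x := by
        have : orthProj u u = 0 := by
          rw [Submodule.orthogonalProjectionOnto_eq_zero_iff, Submodule.orthogonal_orthogonal]
          exact Submodule.mem_span_singleton_self u
        rw [map_add, map_smul, this, smul_zero, add_zero]
      refine ⟨x + (s - ⟪u, x⟫) • u, ⟨by rwa [e1], by rw [e2]; exact mem_image_of_mem _ hx⟩, ?_⟩
      simp only [e1, e2, hg x hx]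

variable {M : Set (Euc n)} {I₀ : Set ℝ} {Φ : Euc n × ℝ → Euc n} {u a : Euc n} {s₀ : ℝ}
  {D : Euc n →L[ℝ] Euc n}

theorem exists_volume_image_le (hu : ‖u‖ = 1) (hT : StrictTangent M u a)
    (hD : StrictDeriv M I₀ Φ u D (a, s₀)) {m : ℝ≥0} (hm : ENNReal.ofReal |D.det| < m) :
    ∃ U ∈ 𝓝[M] a, ∃ V ∈ 𝓝[I₀] s₀, ∀ A ⊆ U, ∀ I ⊆ V,
      volume (Φ '' (A ×ˢ I)) ≤ m * (μHE[n - 1] A * volume I) := by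
  obtain ⟨δ, hδ, hδ0⟩ := ((addHaar_image_le_mul_of_det_lt volume D hm).and
    self_mem_nhdsWithin).exists
  obtain ⟨U, hU, V, hV, h⟩ := exists_approximatesLinearOn_slab hu hT hD hδ0
  refine ⟨U, hU, V, hV, fun A hA I hI => ?_⟩
  obtain ⟨F, hF, hF'⟩ := h A hA I hI
  have := hδ _ _ hF
  rw [hF', volume_slab hu] at this
  refine this.trans ?_
  rw [mul_comm (volume I)]
  gcongr
  exact euclideanHausdorffMeasure_orthProj_image_le hu A

theorem exists_le_volume_image (hu : ‖u‖ = 1) (hT : StrictTangent M u a)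
    (hD : StrictDeriv M I₀ Φ u D (a, s₀)) {m : ℝ≥0} (hm : (m : ℝ≥0∞) < ENNReal.ofReal |D.det|) :
    ∃ U ∈ 𝓝[M] a, ∃ V ∈ 𝓝[I₀] s₀, ∀ A ⊆ U, ∀ I ⊆ V,
      m * (μHE[n - 1] A * volume I) ≤ volume (Φ '' (A ×ˢ I)) := by
  obtain ⟨m', hm', hm''⟩ := ENNReal.lt_iff_exists_nnreal_btwn.1 hm
  have hmm : m < m' := by exact_mod_cast hm'
  -- Projecting may lose a factor `L ^ (n - 1)` of area; the gap between `m` and `m'` absorbs it.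
  obtain ⟨L, hL1, hL⟩ : ∃ L : ℝ≥0, 1 < L ∧ L ^ (n - 1) * m < m' := by
    have hc : ContinuousAt (fun L : ℝ≥0 => L ^ (n - 1) * m) 1 := by fun_prop
    have h1 : ∀ᶠ L in 𝓝[>] (1 : ℝ≥0), L ^ (n - 1) * m < m' :=
      nhdsWithin_le_nhds (hc.eventually (gt_mem_nhds (by simpa using hmm)))
    obtain ⟨L, hL, hL'⟩ := (h1.and self_mem_nhdsWithin).exists
    exact ⟨L, hL', hL⟩
  obtain ⟨δ, hδ, hδ0⟩ := ((mul_le_addHaar_image_of_lt_det volume D hm'').and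
    self_mem_nhdsWithin).exists
  obtain ⟨U, hU, V, hV, h⟩ := exists_approximatesLinearOn_slab hu hT hD hδ0
  obtain ⟨U', hU', h'⟩ := hT.eventually_norm_le hu hL1
  refine ⟨U ∩ U', inter_mem hU hU', V, hV, fun A hA I hI => ?_⟩
  obtain ⟨F, hF, hF'⟩ := h A (hA.trans inter_subset_left) I hI
  have := hδ _ _ hF
  rw [hF', volume_slab hu] at this
  refine le_trans ?_ this
  have h2 := euclideanHausdorffMeasure_le_orthProj_image hu (A := A) (L := L)
    fun x hx y hy => h' x (hA hx).2 y (hA hy).2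
  calc (m : ℝ≥0∞) * (μHE[n - 1] A * volume I)
      ≤ m * (L ^ (n - 1) * volume (orthProj u '' A) * volume I) := by gcongr
    _ = (L ^ (n - 1) * m : ℝ≥0) * (volume I * volume (orthProj u '' A)) := by push_cast; ring
    _ ≤ _ := by gcongr

theorem StrictTangent.exists_measure_lt_top (hu : ‖u‖ = 1) (hT : StrictTangent M u a) :
    ∃ U ∈ 𝓝[M] a, μHE[n - 1] U < ∞ := by
  obtain ⟨U, hU, h⟩ := hT.eventually_norm_le hu (L := 2) (by norm_num)
  refine ⟨U ∩ Metric.ball a 1, inter_mem hU (nhdsWithin_le_nhds (Metric.ball_mem_nhds a one_pos)),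
    ?_⟩
  refine (euclideanHausdorffMeasure_le_orthProj_image hu
    fun x hx y hy => h x hx.1 y hy.1).trans_lt ?_
  refine ENNReal.mul_lt_top (by finiteness) ?_
  refine (Metric.isBounded_ball (x := orthProj u a) (r := 1) |>.subset ?_).measure_lt_top
  rintro _ ⟨x, hx, rfl⟩
  rw [Metric.mem_ball, dist_eq_norm, ← map_sub]
  have := mem_ball_iff_norm.1 hx.2
  exact (norm_orthProj_le u _).trans_lt this

end Local

/-! ### From local to global by compactness and additivity -/

section Boxes

variable {α β : Type*} [TopologicalSpace α] [MeasurableSpace α] [OpensMeasurableSpace α]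
  [TopologicalSpace β] [MeasurableSpace β] [OpensMeasurableSpace β]

/-- A property of sets that is additive and holds locally within a compact set holds for it. -/
theorem forall_measurable_subset_of_local {K : Set α} (hK : IsCompact K) {P : Set α → Prop}
    (hP : ∀ A B, MeasurableSet A → MeasurableSet B → Disjoint A B → A ⊆ K → B ⊆ K →
      P A → P B → P (A ∪ B)) (h0 : P ∅)
    (hloc : ∀ a ∈ K, ∃ U ∈ 𝓝[K] a, ∀ A ⊆ U, A ⊆ K → MeasurableSet A → P A)
    {A : Set α} (hA : MeasurableSet A) (hAK : A ⊆ K) : P A := by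
  have key : ∃ O, IsOpen O ∧ K ⊆ O ∧ ∀ A ⊆ O, A ⊆ K → MeasurableSet A → P A := by
    refine hK.induction_on (p := fun S => ∃ O, IsOpen O ∧ S ⊆ O ∧
      ∀ A ⊆ O, A ⊆ K → MeasurableSet A → P A) ?_ ?_ ?_ ?_
    · exact ⟨∅, isOpen_empty, Subset.rfl, fun A hA _ _ => by
        rwa [subset_empty_iff.1 hA]⟩
    · rintro s t hst ⟨O, hO, htO, h⟩
      exact ⟨O, hO, hst.trans htO, h⟩
    · rintro s t ⟨O, hO, hsO, h⟩ ⟨O', hO', htO', h'⟩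
      refine ⟨O ∪ O', hO.union hO', union_subset_union hsO htO', fun A hA hAK hAm => ?_⟩
      rw [← inter_union_sdiff A O]
      refine hP _ _ (hAm.inter hO.measurableSet) (hAm.diff hO.measurableSet)
        disjoint_sdiff_inter.symm (inter_subset_left.trans hAK) (sdiff_subset.trans hAK)
        (h _ inter_subset_right (inter_subset_left.trans hAK) (hAm.inter hO.measurableSet))
        (h' _ ?_ (sdiff_subset.trans hAK) (hAm.diff hO.measurableSet))
      rintro x ⟨hx, hxO⟩
      exact (hA hx).resolve_left hxO
    · intro a ha
      obtain ⟨U, hU, h⟩ := hloc a ha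
      obtain ⟨O, hO, haO, hOU⟩ := mem_nhdsWithin.1 hU
      exact ⟨O ∩ K, inter_mem (nhdsWithin_le_nhds (hO.mem_nhds haO)) self_mem_nhdsWithin, O, hO, inter_subset_left,
        fun A hA hAK => h A (fun x hx => hOU ⟨hA hx, hAK hx⟩) hAK⟩
  obtain ⟨O, -, hKO, h⟩ := key
  exact h A (hAK.trans hKO) hAK hA

/-- A tube-lemma argument: for fixed `a`, finitely many neighbourhoods cover `L`, and the
corresponding neighbourhoods of `a` are intersected. -/
theorem box_of_local {K : Set α} (hK : IsCompact K) {L : Set β} (hL : IsCompact L)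
    {P : Set α → Set β → Prop}
    (hP : ∀ A B I, MeasurableSet A → MeasurableSet B → MeasurableSet I → Disjoint A B →
      A ⊆ K → B ⊆ K → I ⊆ L → P A I → P B I → P (A ∪ B) I)
    (hP' : ∀ A I J, MeasurableSet A → MeasurableSet I → MeasurableSet J → Disjoint I J →
      A ⊆ K → I ⊆ L → J ⊆ L → P A I → P A J → P A (I ∪ J))
    (h0 : ∀ I, P ∅ I) (h0' : ∀ A, P A ∅)
    (hloc : ∀ a ∈ K, ∀ b ∈ L, ∃ U ∈ 𝓝[K] a, ∃ V ∈ 𝓝[L] b, ∀ A ⊆ U, ∀ I ⊆ V, A ⊆ K → I ⊆ L →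
      MeasurableSet A → MeasurableSet I → P A I)
    {A : Set α} (hA : MeasurableSet A) (hAK : A ⊆ K) {I : Set β} (hI : MeasurableSet I)
    (hIL : I ⊆ L) : P A I := by
  refine forall_measurable_subset_of_local hK (P := fun A => P A I)
    (fun A B hA hB hAB hAK hBK h1 h2 => hP A B I hA hB hI hAB hAK hBK hIL h1 h2) (h0 I) ?_ hA hAK
  intro a ha
  have key : ∃ O, IsOpen O ∧ L ⊆ O ∧ ∃ U ∈ 𝓝[K] a, ∀ A ⊆ U, A ⊆ K → MeasurableSet A →
      ∀ I ⊆ O, I ⊆ L → MeasurableSet I → P A I := by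
    refine hL.induction_on (p := fun S => ∃ O, IsOpen O ∧ S ⊆ O ∧ ∃ U ∈ 𝓝[K] a, ∀ A ⊆ U,
      A ⊆ K → MeasurableSet A → ∀ I ⊆ O, I ⊆ L → MeasurableSet I → P A I) ?_ ?_ ?_ ?_
    · exact ⟨∅, isOpen_empty, Subset.rfl, univ, univ_mem, fun A _ _ _ I hI _ _ => by
        rw [subset_empty_iff.1 hI]; exact h0' A⟩
    · rintro s t hst ⟨O, hO, htO, h⟩
      exact ⟨O, hO, hst.trans htO, h⟩
    · rintro s t ⟨O, hO, hsO, U, hU, h⟩ ⟨O', hO', htO', U', hU', h'⟩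
      refine ⟨O ∪ O', hO.union hO', union_subset_union hsO htO', U ∩ U', inter_mem hU hU',
        fun A hA hAK hAm I hI hIL hIm => ?_⟩
      rw [← inter_union_sdiff I O]
      refine hP' _ _ _ hAm (hIm.inter hO.measurableSet) (hIm.diff hO.measurableSet)
        disjoint_sdiff_inter.symm hAK (inter_subset_left.trans hIL) (sdiff_subset.trans hIL)
        (h _ (hA.trans inter_subset_left) hAK hAm _ inter_subset_right
          (inter_subset_left.trans hIL) (hIm.inter hO.measurableSet))
        (h' _ (hA.trans inter_subset_right) hAK hAm _ ?_
          (sdiff_subset.trans hIL) (hIm.diff hO.measurableSet))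
      rintro x ⟨hx, hxO⟩
      exact (hI hx).resolve_left hxO
    · intro b hb
      obtain ⟨U, hU, V, hV, h⟩ := hloc a ha b hb
      obtain ⟨O, hO, hbO, hOV⟩ := mem_nhdsWithin.1 hV
      exact ⟨O ∩ L, inter_mem (nhdsWithin_le_nhds (hO.mem_nhds hbO)) self_mem_nhdsWithin, O, hO, inter_subset_left, U, hU,
        fun A hA hAK hAm I hI hIL hIm =>
          h A hA I (fun x hx => hOV ⟨hI hx, hIL hx⟩) hAK hIL hAm hIm⟩
  obtain ⟨O, -, hLO, U, hU, h⟩ := key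
  exact ⟨U, hU, fun A hA hAK hAm => h A hA hAK hAm I (hIL.trans hLO) hIL hI⟩

end Boxes

/-! ### The area formula on hypersurface times interval -/

section AreaFormula

variable {n : ℕ} {M : Set (Euc n)} {I₀ I : Set ℝ} {Φ : Euc n × ℝ → Euc n} {ν : Euc n → Euc n}
  {D : Euc n × ℝ → Euc n →L[ℝ] Euc n}

theorem measure_lt_top_of_strictTangent (hM : IsCompact M) (hν : ∀ x ∈ M, ‖ν x‖ = 1)
    (hT : ∀ x ∈ M, StrictTangent M (ν x) x) : μHE[n - 1] M < ∞ :=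
  hM.measure_lt_top_of_nhdsWithin fun x hx => (hT x hx).exists_measure_lt_top (hν x hx)

/-- Additivity transfers the comparison of a measure with the volume of images from boxes near
each point of a compact box to the whole. -/
theorem volume_image_box_of_local (hM : IsCompact M) (hI₀ : IsCompact I₀) (hI : MeasurableSet I)
    (hII₀ : I ⊆ I₀) (hΦ : ContinuousOn Φ (M ×ˢ I₀)) (hinj : InjOn Φ (M ×ˢ I))
    (R : ℝ≥0∞ → ℝ≥0∞ → Prop) (hR0 : R 0 0)
    (hR : ∀ a b c d, R a b → R c d → R (a + c) (b + d)) (μ : Measure (Euc n × ℝ))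
    (hloc : ∀ a ∈ M, ∀ s ∈ I₀, ∃ U ∈ 𝓝[M] a, ∃ V ∈ 𝓝[I₀] s, ∀ A ⊆ U, ∀ J ⊆ V, A ⊆ M → J ⊆ I₀ →
      MeasurableSet A → MeasurableSet J → R (volume (Φ '' (A ×ˢ J))) (μ (A ×ˢ J))) :
    R (volume (Φ '' (M ×ˢ I))) (μ (M ×ˢ I)) := by
  have him : ∀ A J, MeasurableSet A → MeasurableSet J → A ⊆ M → J ⊆ I →
      MeasurableSet (Φ '' (A ×ˢ J)) := fun A J hA hJ hAM hJI =>
    (hA.prod hJ).image_of_continuousOn_injOn (hΦ.mono (prod_mono hAM (hJI.trans hII₀)))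
      (hinj.mono (prod_mono hAM hJI))
  have hdisj : ∀ A J A' J', A ⊆ M → A' ⊆ M → J ⊆ I → J' ⊆ I → Disjoint (A ×ˢ J) (A' ×ˢ J') →
      Disjoint (Φ '' (A ×ˢ J)) (Φ '' (A' ×ˢ J')) := fun A J A' J' hA hA' hJ hJ' h =>
    disjoint_image_image fun x hx y hy hxy =>
      disjoint_left.1 h hx (by
        rw [hinj (prod_mono hA hJ hx) (prod_mono hA' hJ' hy) hxy]; exact hy)
  -- Compactness needs the closed `I₀`, injectivity holds only over `I`; hence the property is
  -- stated for `J ∩ I`.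
  have key := box_of_local (α := Euc n) (β := ℝ) hM hI₀
    (P := fun A J => R (volume (Φ '' (A ×ˢ (J ∩ I)))) (μ (A ×ˢ (J ∩ I)))) ?_ ?_ ?_ ?_ ?_
    hM.measurableSet Subset.rfl hI hII₀
  · rwa [inter_self] at key
  · intro A B J hA hB hJ hAB hAK hBK hJL h1 h2
    have hd : Disjoint (A ×ˢ (J ∩ I)) (B ×ˢ (J ∩ I)) := disjoint_prod.2 (Or.inl hAB)
    simp only [union_prod, image_union]
    rw [measure_union (hdisj _ _ _ _ hAK hBK inter_subset_right inter_subset_right hd)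
      (him _ _ hB (hJ.inter hI) hBK inter_subset_right),
      measure_union hd (hB.prod (hJ.inter hI))]
    exact hR _ _ _ _ h1 h2
  · intro A J J' hA hJ hJ' hJJ hAK hJL hJL' h1 h2
    have hd : Disjoint (A ×ˢ (J ∩ I)) (A ×ˢ (J' ∩ I)) :=
      disjoint_prod.2 (Or.inr (hJJ.mono inter_subset_left inter_subset_left))
    simp only [union_inter_distrib_right, prod_union, image_union]
    rw [measure_union (hdisj _ _ _ _ hAK hAK inter_subset_right inter_subset_right hd)
      (him _ _ hA (hJ'.inter hI) hAK inter_subset_right),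
      measure_union hd (hA.prod (hJ'.inter hI))]
    exact hR _ _ _ _ h1 h2
  · intro J; simpa using hR0
  · intro A; simpa using hR0
  · intro a ha s hs
    obtain ⟨U, hU, V, hV, h⟩ := hloc a ha s hs
    exact ⟨U, hU, V, hV, fun A hA J hJ hAM hJI hAm hJm => h A hA (J ∩ I)
      (inter_subset_left.trans hJ) hAM (inter_subset_left.trans hJI) hAm (hJm.inter hI)⟩

/-- The area formula for a map on the product of a hypersurface with an interval. -/
theorem volume_image_eq_lintegral (hM : IsCompact M) (hI₀ : IsCompact I₀) (hI : MeasurableSet I)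
    (hII₀ : I ⊆ I₀) (hΦ : ContinuousOn Φ (M ×ˢ I₀)) (hinj : InjOn Φ (M ×ˢ I))
    (hν : ∀ x ∈ M, ‖ν x‖ = 1) (hT : ∀ x ∈ M, StrictTangent M (ν x) x)
    (hD : ∀ x ∈ M, ∀ s ∈ I₀, StrictDeriv M I₀ Φ (ν x) (D (x, s)) (x, s))
    (hDc : ContinuousOn D (M ×ˢ I₀)) :
    volume (Φ '' (M ×ˢ I)) = ∫⁻ z in M ×ˢ I, ENNReal.ofReal |(D z).det|
      ∂((μHE[n - 1] : Measure (Euc n)).restrict M).prod volume := by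
  have hfin := measure_lt_top_of_strictTangent hM hν hT
  have : IsFiniteMeasure ((μHE[n - 1] : Measure (Euc n)).restrict M) :=
    ⟨by rwa [Measure.restrict_apply_univ]⟩
  set σ := ((μHE[n - 1] : Measure (Euc n)).restrict M).prod (volume : Measure ℝ) with hσ
  have hσbox : ∀ A J, A ⊆ M → σ (A ×ˢ J) = μHE[n - 1] A * volume J := fun A J hA => by
    rw [hσ, Measure.prod_prod, Measure.restrict_eq_self _ hA]
  have hJc : ContinuousOn (fun z => |(D z).det|) (M ×ˢ I₀) :=
    (ContinuousLinearMap.continuous_det.comp_continuousOn hDc).abs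
  have hnear : ∀ a ∈ M, ∀ s ∈ I₀, ∀ ε > (0 : ℝ), ∃ U ∈ 𝓝[M] a, ∃ V ∈ 𝓝[I₀] s, ∀ z ∈ U ×ˢ V,
      |(|(D z).det| - |(D (a, s)).det|)| < ε := by
    intro a ha s hs ε hε
    have := (hJc (a, s) ⟨ha, hs⟩).eventually (Metric.ball_mem_nhds _ hε)
    rw [nhdsWithin_prod_eq] at this
    obtain ⟨U, hU, V, hV, h⟩ := mem_prod_iff.1 this
    exact ⟨U, hU, V, hV, fun z hz => by simpa [Real.dist_eq] using h hz⟩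
  have hσfin : σ (M ×ˢ I) < ∞ := by
    rw [hσbox _ _ Subset.rfl]
    exact ENNReal.mul_lt_top hfin ((measure_mono hII₀).trans_lt hI₀.measure_lt_top)
  -- Half of `ε` makes the constant exceed the Jacobian at the base point; the other half absorbs
  -- the oscillation of the Jacobian.
  have upper : ∀ ε > (0 : ℝ), volume (Φ '' (M ×ˢ I)) ≤
      ∫⁻ z in M ×ˢ I, ENNReal.ofReal (|(D z).det| + ε) ∂σ := by
    intro ε hε
    rw [← withDensity_apply _ (hM.measurableSet.prod hI)]
    refine volume_image_box_of_local hM hI₀ hI hII₀ hΦ hinj (· ≤ ·) le_rfl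
      (fun _ _ _ _ => add_le_add) _ fun a ha s hs => ?_
    obtain ⟨U, hU, V, hV, h⟩ := hnear a ha s hs (ε / 2) (by positivity)
    obtain ⟨U', hU', V', hV', h'⟩ := exists_volume_image_le (hν a ha) (hT a ha) (hD a ha s hs)
      (m := (|(D (a, s)).det| + ε / 2).toNNReal)
      (by rw [← ENNReal.ofReal, ENNReal.ofReal_lt_ofReal_iff (by positivity)]; linarith)
    refine ⟨U ∩ U', inter_mem hU hU', V ∩ V', inter_mem hV hV', fun A hA J hJ hAM hJI hAm hJm => ?_⟩
    refine (h' A (hA.trans inter_subset_right) J (hJ.trans inter_subset_right)).trans ?_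
    rw [withDensity_apply _ (hAm.prod hJm), ← hσbox _ _ hAM, ← setLIntegral_const]
    refine setLIntegral_mono' (hAm.prod hJm) fun z hz => ?_
    rw [← ENNReal.ofReal]
    refine ENNReal.ofReal_le_ofReal ?_
    have := (abs_lt.1 (h z ⟨(hA hz.1).1, (hJ hz.2).1⟩)).1
    linarith
  have lower : ∀ ε > (0 : ℝ), ∫⁻ z in M ×ˢ I, ENNReal.ofReal (|(D z).det| + -ε) ∂σ ≤
      volume (Φ '' (M ×ˢ I)) := by
    intro ε hε
    rw [← withDensity_apply _ (hM.measurableSet.prod hI)]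
    refine volume_image_box_of_local hM hI₀ hI hII₀ hΦ hinj (fun a b => b ≤ a) le_rfl
      (fun _ _ _ _ => add_le_add) _ fun a ha s hs => ?_
    obtain ⟨U, hU, V, hV, h⟩ := hnear a ha s hs (ε / 2) (by positivity)
    have hpt : ∀ A J, A ⊆ U → J ⊆ V → MeasurableSet A → MeasurableSet J → A ⊆ M →
        σ.withDensity (fun z => ENNReal.ofReal (|(D z).det| + -ε)) (A ×ˢ J) ≤
        (|(D (a, s)).det| - ε / 2).toNNReal * (μHE[n - 1] A * volume J) := by
      intro A J hA hJ hAm hJm hAM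
      rw [withDensity_apply _ (hAm.prod hJm), ← hσbox _ _ hAM, ← setLIntegral_const]
      refine setLIntegral_mono' (hAm.prod hJm) fun z hz => ?_
      rw [← ENNReal.ofReal]
      refine ENNReal.ofReal_le_ofReal ?_
      have := (abs_lt.1 (h z ⟨hA hz.1, hJ hz.2⟩)).2
      linarith
    -- At a zero of the Jacobian no constant lies strictly below it, but there the truncated density
    -- vanishes near the point.
    rcases eq_or_lt_of_le (abs_nonneg (D (a, s)).det) with h0 | h0
    · refine ⟨U, hU, V, hV, fun A hA J hJ hAM hJI hAm hJm => (hpt A J hA hJ hAm hJm hAM).trans ?_⟩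
      rw [← h0, Real.toNNReal_of_nonpos (by linarith)]
      simp
    · obtain ⟨U', hU', V', hV', h'⟩ := exists_le_volume_image (hν a ha) (hT a ha) (hD a ha s hs)
        (m := (|(D (a, s)).det| - ε / 2).toNNReal)
        (by rw [← ENNReal.ofReal, ENNReal.ofReal_lt_ofReal_iff h0]; linarith)
      exact ⟨U ∩ U', inter_mem hU hU', V ∩ V', inter_mem hV hV', fun A hA J hJ hAM hJI hAm hJm =>
        (hpt A J (hA.trans inter_subset_left) (hJ.trans inter_subset_left) hAm hJm hAM).trans
          (h' A (hA.trans inter_subset_right) J (hJ.trans inter_subset_right))⟩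
  have hsmall : ∀ r : ℝ≥0, 0 < r → ∃ ε : ℝ, 0 < ε ∧ ENNReal.ofReal ε * σ (M ×ˢ I) ≤ r := by
    intro r hr
    refine ⟨r / ((σ (M ×ˢ I)).toReal + 1), by positivity, ?_⟩
    rw [← ENNReal.ofReal_toReal hσfin.ne, ← ENNReal.ofReal_mul (by positivity),
      ← ENNReal.ofReal_coe_nnreal]
    refine ENNReal.ofReal_le_ofReal ?_
    rw [ENNReal.toReal_ofReal (by positivity), div_mul_eq_mul_div, div_le_iff₀ (by positivity)]
    gcongr
    linarith
  refine le_antisymm ?_ ?_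
  · refine ENNReal.le_of_forall_pos_le_add fun r hr _ => ?_
    obtain ⟨ε, hε, hεr⟩ := hsmall r hr
    calc _ ≤ _ := upper ε hε
      _ ≤ ∫⁻ z in M ×ˢ I, (ENNReal.ofReal |(D z).det| + ENNReal.ofReal ε) ∂σ :=
          lintegral_mono fun z => ENNReal.ofReal_add_le
      _ = ∫⁻ z in M ×ˢ I, ENNReal.ofReal |(D z).det| ∂σ + ENNReal.ofReal ε * σ (M ×ˢ I) := by
          rw [lintegral_add_right _ measurable_const, setLIntegral_const]
      _ ≤ _ := by gcongr
  · refine ENNReal.le_of_forall_pos_le_add fun r hr _ => ?_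
    obtain ⟨ε, hε, hεr⟩ := hsmall r hr
    calc ∫⁻ z in M ×ˢ I, ENNReal.ofReal |(D z).det| ∂σ
        ≤ ∫⁻ z in M ×ˢ I, (ENNReal.ofReal (|(D z).det| + -ε) + ENNReal.ofReal ε) ∂σ :=
          lintegral_mono fun z => by
            refine le_trans (le_of_eq ?_) ENNReal.ofReal_add_le
            congr 1; ring
      _ = ∫⁻ z in M ×ˢ I, ENNReal.ofReal (|(D z).det| + -ε) ∂σ + ENNReal.ofReal ε * σ (M ×ˢ I) := by
          rw [lintegral_add_right _ measurable_const, setLIntegral_const]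
      _ ≤ _ := add_le_add (lower ε hε) hεr

end AreaFormula

/-! ### Determinants of `1 + s W` -/

section LinearAlgebra

/-- Sylvester's identity. It serves to pass from the tangent space to `ℝⁿ` and to compute the
rank-one determinant of the cone. -/
theorem det_one_add_comp_comm {U V : Type*} [AddCommGroup U] [Module ℝ U] [FiniteDimensional ℝ U]
    [AddCommGroup V] [Module ℝ V] [FiniteDimensional ℝ V] (f : U →ₗ[ℝ] V) (g : V →ₗ[ℝ] U) :
    LinearMap.det (1 + f ∘ₗ g) = LinearMap.det (1 + g ∘ₗ f) := by
  classical
  let bU := finBasis ℝ U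
  let bV := finBasis ℝ V
  rw [← LinearMap.det_toMatrix bV, ← LinearMap.det_toMatrix bU, map_add, map_add,
    LinearMap.toMatrix_comp bV bU bV, LinearMap.toMatrix_comp bU bV bU, LinearMap.toMatrix_one,
    LinearMap.toMatrix_one, Matrix.det_one_add_mul_comm]

variable {U : Type*} [NormedAddCommGroup U] [InnerProductSpace ℝ U] [FiniteDimensional ℝ U]

theorem det_one_add_smul_eq_prod {W : U →ₗ[ℝ] U} (hW : W.IsSymmetric) (s : ℝ) :
    LinearMap.det (1 + s • W) = ∏ i, (1 + s * hW.eigenvalues rfl i) := by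
  have h := LinearMap.IsSymmetric.toMatrix_eigenvectorBasis hW rfl
  rw [← LinearMap.det_toMatrix (hW.eigenvectorBasis rfl).toBasis, map_add, map_smul, h,
    LinearMap.toMatrix_one]
  have : (1 : Matrix (Fin (finrank ℝ U)) (Fin (finrank ℝ U)) ℝ) +
      s • Matrix.diagonal (RCLike.ofReal ∘ hW.eigenvalues rfl) =
      Matrix.diagonal fun i => 1 + s * hW.eigenvalues rfl i := by
    rw [← Matrix.diagonal_one, ← Matrix.diagonal_smul, Matrix.diagonal_add]
    rfl
  rw [this, Matrix.det_diagonal]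

theorem det_one_add_smul_eq_sum_esymm {W : U →ₗ[ℝ] U} (hW : W.IsSymmetric) (s : ℝ) :
    LinearMap.det (1 + s • W) =
      ∑ j ∈ Finset.range (finrank ℝ U + 1), s ^ j * W.charpoly.roots.esymm j := by
  rw [det_one_add_smul_eq_prod hW, hW.roots_charpoly_eq_eigenvalues rfl, Finset.prod_one_add,
    Finset.sum_powerset, Finset.card_univ, Fintype.card_fin]
  refine Finset.sum_congr rfl fun j _ => ?_
  rw [Finset.esymm_map_val, Finset.mul_sum]
  refine Finset.sum_congr rfl fun t ht => ?_
  rw [Finset.prod_mul_distrib, Finset.prod_const, (Finset.mem_powersetCard.1 ht).2]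
  rfl

theorem det_one_add_smul_nonneg {W : U →ₗ[ℝ] U} (hW : W.IsPositive) {s : ℝ} (hs : 0 ≤ s) :
    0 ≤ LinearMap.det (1 + s • W) := by
  rw [det_one_add_smul_eq_prod hW.isSymmetric]
  refine Finset.prod_nonneg fun i _ => ?_
  have := hW.nonneg_eigenvalues rfl i
  positivity

/-- The coefficients of `det (1 + s T)` as a polynomial in `s` are continuous in `T`. -/
theorem continuousOn_coeff_det {n N : ℕ} {X : Type*} [TopologicalSpace X] {S : Set X}
    {T : X → Euc n →L[ℝ] Euc n} (hT : ContinuousOn T S) {c : X → ℕ → ℝ}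
    (hc : ∀ x ∈ S, ∀ s : ℝ, (1 + s • T x).det = ∑ j ∈ Finset.range N, s ^ j * c x j)
    {j : ℕ} (hj : j < N) : ContinuousOn (fun x => c x j) S := by
  classical
  let b := (EuclideanSpace.basisFun (Fin n) ℝ).toBasis
  let A : X → Matrix (Fin n) (Fin n) ℝ := fun x => LinearMap.toMatrix b b (T x : Euc n →ₗ[ℝ] Euc n)
  have hA : ∀ i k, ContinuousOn (fun x => A x i k) S := by
    intro i k
    have : (fun x => A x i k) = fun x => (EuclideanSpace.proj i : Euc n →L[ℝ] ℝ) (T x (b k)) := by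
      ext x
      simp [A, b, LinearMap.toMatrix_apply]
    rw [this]
    fun_prop
  -- A coefficient is a sum of principal minors, hence polynomial in the matrix entries; no
  -- continuity of eigenvalues is needed.
  have hcoeff : ∀ x ∈ S, c x j = ∑ s ∈ Finset.univ.powersetCard j,
      ((A x).submatrix (Subtype.val : s → Fin n) (Subtype.val : s → Fin n)).det := by
    intro x hx
    rw [← Matrix.coeff_det_one_add_X_smul_eq_sum_minors]
    have hpoly : Matrix.det (1 + (Polynomial.X : Polynomial ℝ) • (A x).map Polynomial.C) =
        ∑ j ∈ Finset.range N, Polynomial.C (c x j) * Polynomial.X ^ j := by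
      refine Polynomial.funext fun s => ?_
      rw [← Polynomial.coe_evalRingHom, RingHom.map_det, Polynomial.coe_evalRingHom]
      have h1 := hc x hx s
      rw [ContinuousLinearMap.det, ← LinearMap.det_toMatrix b] at h1
      simp only [ContinuousLinearMap.toLinearMap_add, ContinuousLinearMap.toLinearMap_smul,
        map_add, map_smul] at h1
      have e1 : LinearMap.toMatrix b b ((1 : Euc n →L[ℝ] Euc n) : Euc n →ₗ[ℝ] Euc n) = 1 :=
        LinearMap.toMatrix_one b
      rw [e1] at h1
      simp only [Polynomial.eval_finsetSum, Polynomial.eval_mul, Polynomial.eval_C,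
        Polynomial.eval_pow, Polynomial.eval_X]
      simp_rw [mul_comm (c x _)]
      rw [← h1]
      congr 1
      ext i k
      by_cases hik : i = k <;> simp [A, hik] <;> exact mul_comm _ _
    rw [hpoly, Polynomial.finsetSum_coeff]
    simp only [Polynomial.coeff_C_mul, Polynomial.coeff_X_pow]
    simp [hj]
  refine ContinuousOn.congr ?_ hcoeff
  refine continuousOn_finsetSum _ fun s _ => ?_
  simp only [Matrix.det_apply]
  refine continuousOn_finsetSum _ fun σ _ => ContinuousOn.const_smul ?_ _
  exact continuousOn_finsetProd _ fun i _ => hA _ _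

end LinearAlgebra

section

variable {n : ℕ}

/-! ### Outward normals: tangency and uniqueness -/

section Normals

/-- The supporting inequalities at `x` and at `y` bound `⟪ν a, x - y⟫` from both sides, up to the
variation of `ν`. As no smoothness of `M` enters, this also applies to the parallel body. -/
theorem strictTangent_of_normal {M : Set (Euc n)} {ν : Euc n → Euc n} (hc : ContinuousOn ν M)
    (hN : ∀ x ∈ M, ∀ y ∈ M, ⟪ν x, y - x⟫ ≤ 0) {a : Euc n} (ha : a ∈ M) :
    StrictTangent M (ν a) a := by
  refine Asymptotics.isLittleO_iff.2 fun ε hε => ?_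
  have h1 : ∀ᶠ x in 𝓝[M] a, x ∈ M ∧ ‖ν a - ν x‖ < ε := by
    filter_upwards [self_mem_nhdsWithin, (hc a ha).eventually (Metric.ball_mem_nhds _ hε)]
      with x hxM hx
    exact ⟨hxM, by rwa [← dist_eq_norm, dist_comm]⟩
  filter_upwards [h1.prod_mk h1] with p hp
  obtain ⟨⟨hx, hxε⟩, ⟨hy, hyε⟩⟩ := hp
  have key : ∀ x y, x ∈ M → y ∈ M → ‖ν a - ν y‖ < ε → ⟪ν a, x - y⟫ ≤ ε * ‖x - y‖ := by
    intro x y hx hy hy'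
    have e1 : ⟪ν a, x - y⟫ = ⟪ν a - ν y, x - y⟫ + ⟪ν y, x - y⟫ := by
      rw [inner_sub_left]; ring
    have e2 := hN y hy x hx
    have e3 := real_inner_le_norm (ν a - ν y) (x - y)
    have e4 : ‖ν a - ν y‖ * ‖x - y‖ ≤ ε * ‖x - y‖ := by gcongr
    linarith
  rw [Real.norm_eq_abs, abs_le]
  refine ⟨?_, key _ _ hx hy hyε⟩
  have := key _ _ hy hx hxε
  rw [← neg_sub p.1 p.2, inner_neg_right, norm_neg] at this
  linarith

variable {K : Set (Euc n)} {x u v : Euc n}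

theorem IsClassC2.exists_gradient (hK : IsClassC2 K) (hKc : IsClosed K) (hx : x ∈ frontier K) :
    ∃ g : Euc n, g ≠ 0 ∧ ∀ w, ⟪g, w⟫ < 0 → ∀ᶠ t in 𝓝[>] (0 : ℝ), x + t • w ∈ interior K := by
  obtain ⟨U, hU, hxU, φ, hφ, hφx, hKU⟩ := hK x hx
  refine ⟨(InnerProductSpace.toDual ℝ (Euc n)).symm (fderiv ℝ φ x), by simpa using hφx,
    fun w hw => ?_⟩
  rw [InnerProductSpace.toDual_symm_apply] at hw
  have hd : HasFDerivAt φ (fderiv ℝ φ x) x :=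
    ((hφ.contDiffAt (hU.mem_nhds hxU)).differentiableAt (by norm_num)).hasFDerivAt
  have hφ0 : φ x ≤ 0 := by
    have : x ∈ K ∩ U := ⟨hKc.frontier_subset hx, hxU⟩
    rw [hKU] at this
    exact this.2
  have hl : HasDerivAt (fun t : ℝ => x + t • w) w 0 := by
    simpa using ((hasDerivAt_id (0 : ℝ)).smul_const w).const_add x
  have hg : HasDerivAt (fun t : ℝ => φ (x + t • w)) (fderiv ℝ φ x w) 0 :=
    HasFDerivAt.comp_hasDerivAt_of_eq (0 : ℝ) hd hl (by simp)
  have hneg : ∀ᶠ t in 𝓝[>] (0 : ℝ), φ (x + t • w) < 0 := by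
    have h1 := hg.tendsto_slope_zero_right
    filter_upwards [h1.eventually (gt_mem_nhds hw), self_mem_nhdsWithin] with t ht ht0
    simp only [zero_add, zero_smul, add_zero, smul_eq_mul] at ht
    have ht0' : (0 : ℝ) < t := ht0
    have := (inv_mul_lt_iff₀ ht0').1 ht
    linarith
  have hUt : ∀ᶠ t in 𝓝[>] (0 : ℝ), x + t • w ∈ U := by
    refine nhdsWithin_le_nhds (hl.continuousAt.eventually ?_)
    simpa using hU.mem_nhds hxU
  filter_upwards [hneg, hUt] with t ht htU
  rw [mem_interior_iff_mem_nhds]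
  have hφc : ContinuousAt φ (x + t • w) := (hφ.contDiffAt (hU.mem_nhds htU)).continuousAt
  filter_upwards [hφc.eventually (gt_mem_nhds ht), hU.mem_nhds htU] with y hy hyU
  have : y ∈ {y ∈ U | φ y ≤ 0} := ⟨hyU, hy.le⟩
  rw [← hKU] at this
  exact this.1

/-- A normal is nonpositive on the open half-space of directions entering `K`, and by continuity on
its closure. Testing it on its own component orthogonal to `g` forces equality in Cauchy–Schwarz. -/
theorem IsClassC2.normal_unique (hK : IsClassC2 K) (hKc : IsClosed K) (hx : x ∈ frontier K)
    (hu : IsOuterUnitNormal K x u) (hv : IsOuterUnitNormal K x v) : u = v := by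
  obtain ⟨g, hg0, hg⟩ := hK.exists_gradient hKc hx
  suffices h : ∀ u, IsOuterUnitNormal K x u → u = ‖g‖⁻¹ • g by rw [h u hu, h v hv]
  intro u hu
  have h1 : ∀ w, ⟪g, w⟫ < 0 → ⟪u, w⟫ ≤ 0 := by
    intro w hw
    obtain ⟨t, ht, ht0⟩ := ((hg w hw).and self_mem_nhdsWithin).exists
    have ht0' : (0 : ℝ) < t := ht0
    have h := hu.2 _ (interior_subset ht)
    rw [add_sub_cancel_left, inner_smul_right] at h
    exact nonpos_of_mul_nonpos_right h ht0'
  have hgg : 0 < ⟪g, g⟫ := real_inner_self_pos.2 hg0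
  have h2 : ∀ w, ⟪g, w⟫ ≤ 0 → ⟪u, w⟫ ≤ 0 := by
    intro w hw
    have hlim : Tendsto (fun t : ℝ => ⟪u, w - t • g⟫) (𝓝[>] 0) (𝓝 ⟪u, w⟫) := by
      have : ContinuousAt (fun t : ℝ => ⟪u, w - t • g⟫) 0 := by fun_prop
      simpa using this.tendsto.mono_left nhdsWithin_le_nhds
    refine le_of_tendsto hlim ?_
    filter_upwards [self_mem_nhdsWithin] with t ht
    have ht' : (0 : ℝ) < t := ht
    refine h1 _ ?_
    rw [inner_sub_right, inner_smul_right]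
    nlinarith
  have h3 : ⟪u, u - (⟪g, u⟫ / ⟪g, g⟫) • g⟫ ≤ 0 := by
    refine h2 _ (le_of_eq ?_)
    rw [inner_sub_right, inner_smul_right]
    field_simp
    ring
  have h4 : 0 ≤ ⟪u, g⟫ := by
    have := h2 (-g) (by rw [inner_neg_right]; linarith)
    rw [inner_neg_right] at this
    linarith
  have hgn : 0 < ‖g‖ := norm_pos_iff.2 hg0
  have h5 : ‖g‖ ≤ ⟪u, g⟫ := by
    rw [inner_sub_right, inner_smul_right, real_inner_self_eq_norm_sq, hu.1,
      real_inner_self_eq_norm_sq, sub_nonpos, div_mul_eq_mul_div,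
      le_div_iff₀ (by positivity)] at h3
    rw [real_inner_comm u g] at h3
    nlinarith
  have h6 : ⟪u, ‖g‖⁻¹ • g⟫ = 1 := by
    rw [inner_smul_right]
    refine le_antisymm ?_ ?_
    · rw [inv_mul_le_iff₀ hgn, mul_one]
      simpa [hu.1] using real_inner_le_norm u g
    · rw [le_inv_mul_iff₀ hgn, mul_one]
      exact h5
  exact (inner_eq_one_iff_of_norm_eq_one hu.1
    (by rw [norm_smul, norm_inv, norm_norm, inv_mul_cancel₀ hgn.ne'])).1 h6

/-- The default value `0` is not on the sphere, so a value on the sphere certifies that a normal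
exists. -/
theorem gaussMap_normal (h : gaussMap K x ∈ Metric.sphere (0 : Euc n) 1) :
    IsOuterUnitNormal K x (gaussMap K x) := by
  by_cases hex : ∃ u, IsOuterUnitNormal K x u
  · rw [gaussMap, dif_pos hex]
    exact hex.choose_spec
  · rw [gaussMap, dif_neg hex] at h
    simp at h

theorem gaussMap_eq_of_unique (hu : IsOuterUnitNormal K x u)
    (h : ∀ v, IsOuterUnitNormal K x v → v = u) : gaussMap K x = u := by
  have hex : ∃ u, IsOuterUnitNormal K x u := ⟨u, hu⟩
  rw [gaussMap, dif_pos hex]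
  exact h _ hex.choose_spec

theorem IsClassC2Plus.normal (hK : IsClassC2Plus K) (hx : x ∈ frontier K) :
    IsOuterUnitNormal K x (gaussMap K x) := gaussMap_normal (hK.mapsTo hx)

theorem IsClassC2Plus.gaussMap_eq (hK : IsClassC2Plus K) (hKc : IsClosed K) (hx : x ∈ frontier K)
    (hu : IsOuterUnitNormal K x u) : gaussMap K x = u :=
  hK.classC2.normal_unique hKc hx (hK.normal hx) hu

end Normals

/-! ### The reverse Gauss map as gradient of the support function -/

section Homogeneous

/-- The extension of a map on the unit sphere to a map that is homogeneous of degree `0`. -/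
def homExt (ξ : Euc n → Euc n) (v : Euc n) : Euc n := ξ (‖v‖⁻¹ • v)

theorem norm_inv_smul_mem_sphere {v : Euc n} (hv : v ≠ 0) :
    ‖v‖⁻¹ • v ∈ Metric.sphere (0 : Euc n) 1 := by
  rw [mem_sphere_zero_iff_norm, norm_smul, norm_inv, norm_norm,
    inv_mul_cancel₀ (norm_ne_zero_iff.2 hv)]

theorem homExt_of_norm {ξ : Euc n → Euc n} {u : Euc n} (hu : ‖u‖ = 1) : homExt ξ u = ξ u := by
  rw [homExt, hu, inv_one, one_smul]

theorem contDiffAt_normalize {v : Euc n} (hv : v ≠ 0) :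
    ContDiffAt ℝ 1 (fun v : Euc n => ‖v‖⁻¹ • v) v :=
  ((contDiffAt_norm ℝ hv).inv (norm_ne_zero_iff.2 hv)).smul contDiffAt_id

/-- Differentiate `‖v‖ • (‖v‖⁻¹ • v) = v`; the derivative of the norm vanishes on vectors orthogonal
to `u`. -/
theorem fderiv_normalize_apply {u w : Euc n} (hu : ‖u‖ = 1) (hw : ⟪u, w⟫ = 0) :
    fderiv ℝ (fun v : Euc n => ‖v‖⁻¹ • v) u w = w := by
  have hu0 : u ≠ 0 := by rintro rfl; simp at hu
  have h1 : HasFDerivAt (fun v : Euc n => ‖v‖) (fderiv ℝ (fun v : Euc n => ‖v‖) u) u :=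
    ((contDiffAt_norm ℝ (n := 1) hu0).differentiableAt (by norm_num)).hasFDerivAt
  have h2 := ((contDiffAt_normalize hu0).differentiableAt (by norm_num)).hasFDerivAt
  have h3 := h1.smul h2
  have h4 : HasFDerivAt (fun v : Euc n => ‖v‖ • ‖v‖⁻¹ • v) (ContinuousLinearMap.id ℝ (Euc n)) u := by
    refine (hasFDerivAt_id u).congr_of_eventuallyEq ?_
    filter_upwards [isOpen_ne.mem_nhds hu0] with v hv
    rw [smul_smul, mul_inv_cancel₀ (norm_ne_zero_iff.2 hv), one_smul, id]
  have h5 := congrArg (fun L : Euc n →L[ℝ] Euc n => L w) (h3.unique h4)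
  have h6 : fderiv ℝ (fun v : Euc n => ‖v‖) u w = 0 := by
    have e1 := (hasStrictFDerivAt_norm_sq u).hasFDerivAt
    have e2 := h1.pow 2
    have e3 := congrArg (fun L : Euc n →L[ℝ] ℝ => L w) (e2.unique e1)
    simpa [hu, hw] using e3
  simpa [hu, h6] using h5

variable {ξ : Euc n → Euc n}

theorem contDiffAt_homExt (hξ : ContDiffOn ℝ 1 ξ (Metric.sphere 0 1)) {v : Euc n} (hv : v ≠ 0) :
    ContDiffAt ℝ 1 (homExt ξ) v := by
  have h : ContDiffOn ℝ 1 (homExt ξ) {0}ᶜ :=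
    hξ.comp (fun v hv => (contDiffAt_normalize hv).contDiffWithinAt)
      fun v hv => norm_inv_smul_mem_sphere hv
  exact h.contDiffAt (isOpen_compl_singleton.mem_nhds hv)

theorem inner_homExt_sub_nonpos
    (hs : ∀ u ∈ Metric.sphere (0 : Euc n) 1, ∀ v ∈ Metric.sphere (0 : Euc n) 1,
      ⟪u, ξ v - ξ u⟫ ≤ 0) {v w : Euc n} (hv : v ≠ 0) (hw : w ≠ 0) :
    ⟪v, homExt ξ w - homExt ξ v⟫ ≤ 0 := by
  have h := hs _ (norm_inv_smul_mem_sphere hv) _ (norm_inv_smul_mem_sphere hw)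
  rw [real_inner_smul_left] at h
  exact nonpos_of_mul_nonpos_right h (inv_pos.2 (norm_pos_iff.2 hv))

variable (hξ : ContDiffOn ℝ 1 ξ (Metric.sphere 0 1))
  (hs : ∀ u ∈ Metric.sphere (0 : Euc n) 1, ∀ v ∈ Metric.sphere (0 : Euc n) 1,
      ⟪u, ξ v - ξ u⟫ ≤ 0) {u : Euc n} (hu : u ≠ 0)
include hξ hu

theorem hasStrictFDerivAt_homExt :
    HasStrictFDerivAt (homExt ξ) (fderiv ℝ (homExt ξ) u) u :=
  (contDiffAt_homExt hξ hu).hasStrictFDerivAt (by norm_num)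

include hs

/-- First-order condition: `v ↦ ⟪u, homExt ξ v⟫` is maximal at `v = u`. -/
theorem inner_fderiv_homExt (w : Euc n) : ⟪u, fderiv ℝ (homExt ξ) u w⟫ = 0 := by
  have h1 := (hasStrictFDerivAt_homExt hξ hu).hasFDerivAt
  have h2 : HasFDerivAt (fun v => ⟪u, homExt ξ v⟫)
      ((innerSL ℝ u).comp (fderiv ℝ (homExt ξ) u)) u :=
    (innerSL ℝ u).hasFDerivAt.comp u h1
  have h3 : IsLocalMax (fun v => ⟪u, homExt ξ v⟫) u := by
    filter_upwards [isOpen_ne.mem_nhds hu] with v hv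
    have := inner_homExt_sub_nonpos hs hu hv
    rw [inner_sub_right] at this
    linarith
  have h4 := h3.hasFDerivAt_eq_zero h2
  simpa using congrArg (fun L : Euc n →L[ℝ] ℝ => L w) h4

/-- By `inner_fderiv_homExt`, `homExt ξ` is the gradient of the support function `v ↦ ⟪homExt ξ v,
v⟫`, so its derivative is a Hessian. -/
theorem fderiv_homExt_symm (v w : Euc n) :
    ⟪fderiv ℝ (homExt ξ) u v, w⟫ = ⟪v, fderiv ℝ (homExt ξ) u w⟫ := by
  let J : Euc n →ₗ[ℝ] (Euc n →L[ℝ] ℝ) :=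
    { toFun := fun y => innerSL ℝ y
      map_add' := fun y z => map_add _ y z
      map_smul' := fun c y => by ext z; simp }
  have hf : ∀ᶠ y in 𝓝 u, HasFDerivAt (fun v => ⟪homExt ξ v, v⟫)
      ((LinearMap.toContinuousLinearMap J ∘ homExt ξ) y) y := by
    filter_upwards [isOpen_ne.mem_nhds hu] with y hy
    have h1 := (hasStrictFDerivAt_homExt hξ hy).hasFDerivAt.inner ℝ (hasFDerivAt_id y)
    refine h1.congr_fderiv ?_
    ext w
    have := inner_fderiv_homExt hξ hs hy w
    rw [real_inner_comm] at this
    simp [J, this]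
  have hx := ((LinearMap.toContinuousLinearMap J).hasFDerivAt (x := homExt ξ u)).comp u
    (hasStrictFDerivAt_homExt hξ hu).hasFDerivAt
  have := second_derivative_symmetric_of_eventually hf hx v w
  simp only [ContinuousLinearMap.comp_apply] at this
  rw [real_inner_comm _ v]
  exact this

theorem fderiv_homExt_self : fderiv ℝ (homExt ξ) u u = 0 := by
  refine ext_inner_left ℝ fun v => ?_
  rw [← fderiv_homExt_symm hξ hs hu, inner_zero_right, real_inner_comm,
    inner_fderiv_homExt hξ hs hu]

/-- Adding the support inequalities at `u` and `u + t w` shows that `homExt ξ` is monotone. -/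
theorem inner_fderiv_homExt_nonneg (w : Euc n) : 0 ≤ ⟪fderiv ℝ (homExt ξ) u w, w⟫ := by
  have hl : HasDerivAt (fun t : ℝ => u + t • w) w 0 := by
    simpa using ((hasDerivAt_id (0 : ℝ)).smul_const w).const_add u
  have h1 : HasDerivAt (fun t : ℝ => homExt ξ (u + t • w)) (fderiv ℝ (homExt ξ) u w) 0 :=
    HasFDerivAt.comp_hasDerivAt_of_eq (l := homExt ξ) (0 : ℝ) (hasStrictFDerivAt_homExt hξ hu).hasFDerivAt hl
      (by simp)
  have h2 := (h1.tendsto_slope_zero_right).inner (𝕜 := ℝ) (tendsto_const_nhds (x := w))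
  refine ge_of_tendsto h2 ?_
  have hne : ∀ᶠ t in 𝓝[>] (0 : ℝ), u + t • w ≠ 0 :=
    nhdsWithin_le_nhds (hl.continuousAt.eventually_ne (by simpa using hu))
  filter_upwards [hne, self_mem_nhdsWithin] with t ht ht0
  have ht0' : (0 : ℝ) < t := ht0
  have e1 := inner_homExt_sub_nonpos hs hu ht
  have e2 := inner_homExt_sub_nonpos hs ht hu
  simp only [zero_add, zero_smul, add_zero]
  rw [real_inner_smul_left]
  refine mul_nonneg (inv_nonneg.2 ht0'.le) ?_
  rw [inner_add_left, real_inner_smul_left] at e2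
  rw [← neg_sub, inner_neg_right, inner_neg_right] at e2
  rw [real_inner_comm]
  by_contra hlt
  push Not at hlt
  nlinarith

end Homogeneous

/-! ### The Weingarten map and strict differentiability of the Gauss map -/

section Weingarten

variable {K : Set (Euc n)} {x : Euc n}

/-- The reverse Gauss map. -/
def IsClassC2Plus.reverseGauss (hK : IsClassC2Plus K) : Euc n → Euc n := hK.exists_inverse.choose

theorem IsClassC2Plus.reverseGauss_mapsTo (hK : IsClassC2Plus K) :
    MapsTo hK.reverseGauss (Metric.sphere 0 1) (frontier K) :=
  hK.exists_inverse.choose_spec.1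

theorem IsClassC2Plus.contDiffOn_reverseGauss (hK : IsClassC2Plus K) :
    ContDiffOn ℝ 1 hK.reverseGauss (Metric.sphere 0 1) :=
  hK.exists_inverse.choose_spec.2.1

theorem IsClassC2Plus.invOn (hK : IsClassC2Plus K) :
    InvOn hK.reverseGauss (gaussMap K) (frontier K) (Metric.sphere 0 1) :=
  hK.exists_inverse.choose_spec.2.2

theorem IsClassC2Plus.norm_gaussMap (hK : IsClassC2Plus K) (hx : x ∈ frontier K) :
    ‖gaussMap K x‖ = 1 := (hK.normal hx).1

theorem IsClassC2Plus.gaussMap_ne_zero (hK : IsClassC2Plus K) (hx : x ∈ frontier K) :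
    gaussMap K x ≠ 0 := by
  rw [← norm_ne_zero_iff, hK.norm_gaussMap hx]
  exact one_ne_zero

theorem IsClassC2Plus.inner_reverseGauss_sub (hK : IsClassC2Plus K) (hKc : IsClosed K) :
    ∀ u ∈ Metric.sphere (0 : Euc n) 1, ∀ v ∈ Metric.sphere (0 : Euc n) 1,
      ⟪u, hK.reverseGauss v - hK.reverseGauss u⟫ ≤ 0 := by
  intro u hu v hv
  have h := (hK.normal (hK.reverseGauss_mapsTo hu)).2 _
    (hKc.frontier_subset (hK.reverseGauss_mapsTo hv))
  rwa [hK.invOn.2 hu] at h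

/-- The differential of the reverse Gauss map at the normal at `x`, extended to the normal
direction by `0`. -/
def IsClassC2Plus.dReverse (hK : IsClassC2Plus K) (x : Euc n) : Euc n →L[ℝ] Euc n :=
  fderiv ℝ (homExt hK.reverseGauss) (gaussMap K x)

theorem mem_orthogonal_span_iff {u w : Euc n} : w ∈ (ℝ ∙ u)ᗮ ↔ ⟪u, w⟫ = 0 :=
  Submodule.mem_orthogonal_singleton_iff_inner_right

theorem orthProj_self (u : Euc n) : orthProj u u = 0 := by
  rw [Submodule.orthogonalProjectionOnto_eq_zero_iff, Submodule.orthogonal_orthogonal]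
  exact Submodule.mem_span_singleton_self u

theorem orthProj_coe {u : Euc n} (w : (ℝ ∙ u)ᗮ) : orthProj u w = w :=
  Submodule.orthogonalProjectionOnto_mem_subspace_eq_self w

theorem coe_orthProj_of_inner {u w : Euc n} (hw : ⟪u, w⟫ = 0) : (orthProj u w : Euc n) = w :=
  congrArg Subtype.val (orthProj_coe ⟨w, mem_orthogonal_span_iff.2 hw⟩)

theorem IsClassC2Plus.inner_dReverse (hK : IsClassC2Plus K) (hKc : IsClosed K)
    (hx : x ∈ frontier K) (w : Euc n) : ⟪gaussMap K x, hK.dReverse x w⟫ = 0 :=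
  inner_fderiv_homExt hK.contDiffOn_reverseGauss (hK.inner_reverseGauss_sub hKc)
    (hK.gaussMap_ne_zero hx) w

theorem IsClassC2Plus.dReverse_gaussMap (hK : IsClassC2Plus K) (hKc : IsClosed K)
    (hx : x ∈ frontier K) : hK.dReverse x (gaussMap K x) = 0 :=
  fderiv_homExt_self hK.contDiffOn_reverseGauss (hK.inner_reverseGauss_sub hKc)
    (hK.gaussMap_ne_zero hx)

theorem IsClassC2Plus.homExt_gaussMap (hK : IsClassC2Plus K) (hx : x ∈ frontier K) :
    homExt hK.reverseGauss (gaussMap K x) = x := by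
  rw [homExt_of_norm (hK.norm_gaussMap hx), hK.invOn.1 hx]

/-- Chain rule for `ν ∘ homExt ξ`, which is normalization on the open set `{0}ᶜ`. The argument works
for whichever derivative `fderivWithin` selects. -/
theorem IsClassC2Plus.fderivWithin_dReverse (hK : IsClassC2Plus K) (hx : x ∈ frontier K)
    {w : Euc n} (hw : ⟪gaussMap K x, w⟫ = 0) :
    fderivWithin ℝ (gaussMap K) (frontier K) x (hK.dReverse x w) = w := by
  have hu0 := hK.gaussMap_ne_zero hx
  have h1 : HasFDerivWithinAt (gaussMap K) (fderivWithin ℝ (gaussMap K) (frontier K) x)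
      (frontier K) (homExt hK.reverseGauss (gaussMap K x)) := by
    rw [hK.homExt_gaussMap hx]
    exact (hK.contDiffOn.differentiableOn (by norm_num) x hx).hasFDerivWithinAt
  have h2 := (hasStrictFDerivAt_homExt hK.contDiffOn_reverseGauss
    hu0).hasFDerivAt.hasFDerivWithinAt (s := {0}ᶜ)
  have h3 := (h1.comp (gaussMap K x) h2 fun v hv =>
    hK.reverseGauss_mapsTo (norm_inv_smul_mem_sphere hv)).hasFDerivAt
      (isOpen_compl_singleton.mem_nhds hu0)
  have h4 : (gaussMap K ∘ homExt hK.reverseGauss) =ᶠ[𝓝 (gaussMap K x)]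
      fun v => ‖v‖⁻¹ • v := by
    filter_upwards [isOpen_ne.mem_nhds hu0] with v hv
    exact hK.invOn.2 (norm_inv_smul_mem_sphere hv)
  have h5 := (h3.congr_of_eventuallyEq h4.symm).fderiv
  have h6 := fderiv_normalize_apply (hK.norm_gaussMap hx) hw
  rw [h5] at h6
  exact h6

theorem IsClassC2Plus.weingarten_dReverse (hK : IsClassC2Plus K) (hKc : IsClosed K)
    (hx : x ∈ frontier K) (w : (ℝ ∙ gaussMap K x)ᗮ) :
    weingarten K x (orthProj (gaussMap K x) (hK.dReverse x w)) = w := by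
  have h1 : (orthProj (gaussMap K x) (hK.dReverse x w) : Euc n) = hK.dReverse x w :=
    coe_orthProj_of_inner (hK.inner_dReverse hKc hx w)
  have h2 := hK.fderivWithin_dReverse hx (mem_orthogonal_span_iff.1 w.2)
  have : weingarten K x (orthProj (gaussMap K x) (hK.dReverse x w)) =
      orthProj (gaussMap K x) (fderivWithin ℝ (gaussMap K) (frontier K) x
        (orthProj (gaussMap K x) (hK.dReverse x w))) := rfl
  rw [this, h1, h2, orthProj_coe]

/-- The differential of the reverse Gauss map on the tangent space. -/
def IsClassC2Plus.tangentReverse (hK : IsClassC2Plus K) (x : Euc n) :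
    (ℝ ∙ gaussMap K x)ᗮ →ₗ[ℝ] (ℝ ∙ gaussMap K x)ᗮ :=
  (orthProj (gaussMap K x) ∘L hK.dReverse x ∘L (ℝ ∙ gaussMap K x)ᗮ.subtypeL).toLinearMap

theorem IsClassC2Plus.coe_tangentReverse (hK : IsClassC2Plus K) (hKc : IsClosed K)
    (hx : x ∈ frontier K) (w : (ℝ ∙ gaussMap K x)ᗮ) :
    (hK.tangentReverse x w : Euc n) = hK.dReverse x w :=
  coe_orthProj_of_inner (hK.inner_dReverse hKc hx w)

theorem IsClassC2Plus.weingarten_mul (hK : IsClassC2Plus K) (hKc : IsClosed K)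
    (hx : x ∈ frontier K) : weingarten K x * hK.tangentReverse x = 1 :=
  LinearMap.ext fun w => hK.weingarten_dReverse hKc hx w

theorem IsClassC2Plus.mul_weingarten (hK : IsClassC2Plus K) (hKc : IsClosed K)
    (hx : x ∈ frontier K) : hK.tangentReverse x * weingarten K x = 1 :=
  mul_eq_one_comm.1 (hK.weingarten_mul hKc hx)

/-- Symmetry and positivity pass from the inverse, the restricted Hessian of the support function.
-/
theorem IsClassC2Plus.weingarten_isPositive (hK : IsClassC2Plus K) (hKc : IsClosed K)
    (hx : x ∈ frontier K) : (weingarten K x).IsPositive := by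
  have hinv : ∀ w, hK.tangentReverse x (weingarten K x w) = w := fun w =>
    congrArg (fun L : _ →ₗ[ℝ] _ => L w) (hK.mul_weingarten hKc hx)
  have hB := fun w => hK.coe_tangentReverse hKc hx w
  have hu0 := hK.gaussMap_ne_zero hx
  rw [LinearMap.isPositive_iff]
  constructor
  · intro a b
    conv_lhs => rw [← hinv b]
    conv_rhs => rw [← hinv a]
    rw [Submodule.coe_inner, Submodule.coe_inner, hB, hB]
    exact (fderiv_homExt_symm hK.contDiffOn_reverseGauss (hK.inner_reverseGauss_sub hKc) hu0
      _ _).symm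
  · intro a
    conv_rhs => rw [← hinv a]
    rw [hinv, Submodule.coe_inner, ← hinv a, hB, hinv]
    have := inner_fderiv_homExt_nonneg hK.contDiffOn_reverseGauss
      (hK.inner_reverseGauss_sub hKc) hu0 (weingarten K x a)
    rw [real_inner_comm] at this
    exact this

/-- The Weingarten map, extended to the normal direction by `0`. -/
def shapeOperator (K : Set (Euc n)) (x : Euc n) : Euc n →L[ℝ] Euc n :=
  (ℝ ∙ gaussMap K x)ᗮ.subtypeL ∘L LinearMap.toContinuousLinearMap (weingarten K x) ∘L
    orthProj (gaussMap K x)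

theorem shapeOperator_apply (K : Set (Euc n)) (x w : Euc n) :
    shapeOperator K x w = weingarten K x (orthProj (gaussMap K x) w) := rfl

theorem det_one_add_shapeOperator (K : Set (Euc n)) (x : Euc n) (s : ℝ) :
    (1 + s • shapeOperator K x).det = LinearMap.det (1 + s • weingarten K x) := by
  have h := det_one_add_comp_comm ((ℝ ∙ gaussMap K x)ᗮ.subtype)
    ((s • weingarten K x) ∘ₗ (orthProj (gaussMap K x)).toLinearMap)
  have e : ((s • weingarten K x) ∘ₗ (orthProj (gaussMap K x)).toLinearMap) ∘ₗ
      (ℝ ∙ gaussMap K x)ᗮ.subtype = s • weingarten K x := by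
    ext1 w
    simp
  rw [e] at h
  rw [← h]
  rfl

theorem IsClassC2Plus.det_eq_sum (hn : 1 ≤ n) (hK : IsClassC2Plus K) (hKc : IsClosed K)
    (hx : x ∈ frontier K) (s : ℝ) : (1 + s • shapeOperator K x).det =
      ∑ j ∈ Finset.range n, s ^ j * (principalCurvatures K x).esymm j := by
  rw [det_one_add_shapeOperator, det_one_add_smul_eq_sum_esymm
    (hK.weingarten_isPositive hKc hx).isSymmetric,
    finrank_orthogonal_span (hK.norm_gaussMap hx), Nat.sub_add_cancel hn]
  rfl

theorem IsClassC2Plus.det_nonneg (hK : IsClassC2Plus K) (hKc : IsClosed K)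
    (hx : x ∈ frontier K) {s : ℝ} (hs : 0 ≤ s) : 0 ≤ (1 + s • shapeOperator K x).det := by
  rw [det_one_add_shapeOperator]
  exact det_one_add_smul_nonneg (hK.weingarten_isPositive hKc hx) hs

theorem IsClassC2Plus.shapeOperator_dReverse (hK : IsClassC2Plus K) (hKc : IsClosed K)
    (hx : x ∈ frontier K) (w : Euc n) :
    shapeOperator K x (hK.dReverse x w) = w - ⟪gaussMap K x, w⟫ • gaussMap K x := by
  have e := orthProj_add_smul (hK.norm_gaussMap hx) w
  have h1 : hK.dReverse x w = hK.dReverse x (orthProj (gaussMap K x) w) := by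
    conv_lhs => rw [← e]
    rw [map_add, map_smul, hK.dReverse_gaussMap hKc hx, smul_zero, add_zero]
  rw [shapeOperator_apply, h1, hK.weingarten_dReverse hKc hx, eq_sub_iff_add_eq, e]

theorem IsClassC2Plus.dReverse_shapeOperator (hK : IsClassC2Plus K) (hKc : IsClosed K)
    (hx : x ∈ frontier K) (w : Euc n) :
    hK.dReverse x (shapeOperator K x w) = w - ⟪gaussMap K x, w⟫ • gaussMap K x := by
  have e := orthProj_add_smul (hK.norm_gaussMap hx) w
  rw [shapeOperator_apply, ← hK.coe_tangentReverse hKc hx]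
  have := congrArg
    (fun L : Module.End ℝ (ℝ ∙ gaussMap K x)ᗮ => (L (orthProj (gaussMap K x) w) : Euc n))
    (hK.mul_weingarten hKc hx)
  simp only [Module.End.mul_apply, Module.End.one_apply] at this
  rw [this, eq_sub_iff_add_eq, e]

theorem shapeOperator_gaussMap (K : Set (Euc n)) (x : Euc n) :
    shapeOperator K x (gaussMap K x) = 0 := by
  rw [shapeOperator_apply, orthProj_self, map_zero]
  rfl

theorem inner_shapeOperator (K : Set (Euc n)) (x w : Euc n) :
    ⟪gaussMap K x, shapeOperator K x w⟫ = 0 :=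
  mem_orthogonal_span_iff.1 (weingarten K x (orthProj (gaussMap K x) w)).2

/-- The orthogonal projection onto the line of a unit vector. -/
def lineProj (u : Euc n) : Euc n →L[ℝ] Euc n := (innerSL ℝ u).smulRight u

theorem lineProj_apply (u w : Euc n) : lineProj u w = ⟪u, w⟫ • u := rfl

/-- Adding the projection onto the normal line makes both operators invertible on all of `ℝⁿ` and
inverse to each other. Continuity then follows from that of inversion, without comparing the varying
tangent spaces. -/
theorem IsClassC2Plus.continuousOn_shapeOperator (hK : IsClassC2Plus K) (hKc : IsClosed K) :
    ContinuousOn (shapeOperator K) (frontier K) := by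
  have hu : ∀ x ∈ frontier K, ⟪gaussMap K x, gaussMap K x⟫ = 1 := fun x hx => by
    rw [real_inner_self_eq_norm_sq, hK.norm_gaussMap hx, one_pow]
  have h1 : ∀ x ∈ frontier K, (hK.dReverse x + lineProj (gaussMap K x)) *
      (shapeOperator K x + lineProj (gaussMap K x)) = 1 := by
    intro x hx
    ext1 w
    simp only [mul_apply_eq_comp, add_apply, map_add,
      lineProj_apply, hK.dReverse_shapeOperator hKc hx, inner_shapeOperator, map_smul,
      hK.dReverse_gaussMap hKc hx, hu x hx, one_apply_eq_self]
    simp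
  have h2 : ∀ x ∈ frontier K, (shapeOperator K x + lineProj (gaussMap K x)) *
      (hK.dReverse x + lineProj (gaussMap K x)) = 1 := by
    intro x hx
    ext1 w
    simp only [mul_apply_eq_comp, add_apply, map_add,
      lineProj_apply, hK.shapeOperator_dReverse hKc hx, hK.inner_dReverse hKc hx, map_smul,
      shapeOperator_gaussMap, hu x hx, one_apply_eq_self]
    simp
  have hν := hK.contDiffOn.continuousOn
  have hline : ContinuousOn (fun x => lineProj (gaussMap K x)) (frontier K) := by
    have : Continuous fun u : Euc n => lineProj u := by
      unfold lineProj
      fun_prop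
    exact this.comp_continuousOn hν
  have hB : ContinuousOn (fun x => hK.dReverse x) (frontier K) := by
    intro x hx
    have h := (contDiffAt_homExt hK.contDiffOn_reverseGauss
      (hK.gaussMap_ne_zero hx)).fderiv_right (m := 0) (by norm_num)
    exact h.continuousAt.comp_continuousWithinAt (hν x hx)
  have hinv : ∀ x ∈ frontier K, shapeOperator K x =
      Ring.inverse (hK.dReverse x + lineProj (gaussMap K x)) - lineProj (gaussMap K x) := by
    intro x hx
    let U : (Euc n →L[ℝ] Euc n)ˣ := ⟨_, _, h1 x hx, h2 x hx⟩
    have : Ring.inverse (hK.dReverse x + lineProj (gaussMap K x)) =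
        shapeOperator K x + lineProj (gaussMap K x) := Ring.inverse_unit U
    rw [this, add_sub_cancel_right]
  refine ContinuousOn.congr (ContinuousOn.sub (fun x hx => ?_) hline) hinv
  let U : (Euc n →L[ℝ] Euc n)ˣ := ⟨_, _, h1 x hx, h2 x hx⟩
  have hU : ContinuousAt Ring.inverse (hK.dReverse x + lineProj (gaussMap K x)) :=
    NormedRing.inverse_continuousAt U
  exact ContinuousAt.comp_continuousWithinAt
    (f := fun x => hK.dReverse x + lineProj (gaussMap K x)) hU ((hB.add hline) x hx)

/-- The extended reverse Gauss map is `C¹` on an open set, hence strictly differentiable; applying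
the shape operator to its expansion inverts it, up to the normal part of the difference of two
normals. -/
theorem IsClassC2Plus.isLittleO_gaussMap (hK : IsClassC2Plus K) (hKc : IsClosed K)
    (hx : x ∈ frontier K) :
    (fun p : Euc n × Euc n =>
      gaussMap K p.1 - gaussMap K p.2 - shapeOperator K x (p.1 - p.2))
      =o[𝓝[frontier K] x ×ˢ 𝓝[frontier K] x] (fun p => p.1 - p.2) := by
  set F := 𝓝[frontier K] x ×ˢ 𝓝[frontier K] x
  set u := gaussMap K x
  have hν := (hK.contDiffOn.continuousOn x hx).tendsto
  have hmem : ∀ᶠ p in F, p.1 ∈ frontier K ∧ p.2 ∈ frontier K :=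
    (eventually_mem_nhdsWithin (a := x) (s := frontier K)).prod_mk eventually_mem_nhdsWithin
  have ht : Tendsto (fun p : Euc n × Euc n => (gaussMap K p.1, gaussMap K p.2)) F (𝓝 (u, u)) := by
    rw [nhds_prod_eq]
    exact hν.prodMap hν
  have h1 := ((hasStrictFDerivAt_homExt hK.contDiffOn_reverseGauss
    (hK.gaussMap_ne_zero hx)).isLittleO).comp_tendsto ht
  have h2 : (fun p : Euc n × Euc n => p.1 - p.2 - hK.dReverse x (gaussMap K p.1 - gaussMap K p.2))
      =o[F] (fun p => gaussMap K p.1 - gaussMap K p.2) := by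
    refine h1.congr' ?_ EventuallyEq.rfl
    filter_upwards [hmem] with p hp
    simp only [Function.comp_apply, hK.homExt_gaussMap hp.1, hK.homExt_gaussMap hp.2]
    rfl
  -- A chord of the unit sphere is orthogonal to its midpoint, and the midpoint tends to `u`.
  have h3 : (fun p : Euc n × Euc n => ⟪u, gaussMap K p.1 - gaussMap K p.2⟫ • u)
      =o[F] (fun p => gaussMap K p.1 - gaussMap K p.2) := by
    refine Asymptotics.isLittleO_iff.2 fun ε hε => ?_
    have h : Tendsto (fun p : Euc n × Euc n =>
        ‖u - (1 / 2 : ℝ) • (gaussMap K p.1 + gaussMap K p.2)‖) F (𝓝 0) := by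
      have : Continuous fun q : Euc n × Euc n => ‖u - (1 / 2 : ℝ) • (q.1 + q.2)‖ := by fun_prop
      have h := (this.tendsto (u, u)).comp ht
      rwa [show ‖u - (1 / 2 : ℝ) • (u + u)‖ = 0 by
        rw [← two_smul ℝ u, smul_smul]; norm_num] at h
    filter_upwards [h.eventually (gt_mem_nhds hε), hmem] with p hp hpm
    have e1 : ⟪gaussMap K p.1 + gaussMap K p.2, gaussMap K p.1 - gaussMap K p.2⟫ = 0 := by
      rw [real_inner_add_sub_eq_zero_iff, hK.norm_gaussMap hpm.1, hK.norm_gaussMap hpm.2]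
    have e2 : ⟪u, gaussMap K p.1 - gaussMap K p.2⟫ =
        ⟪u - (1 / 2 : ℝ) • (gaussMap K p.1 + gaussMap K p.2),
          gaussMap K p.1 - gaussMap K p.2⟫ := by
      rw [inner_sub_left, real_inner_smul_left, e1, mul_zero, sub_zero]
    rw [norm_smul, hK.norm_gaussMap hx, mul_one, e2]
    refine (norm_inner_le_norm _ _).trans ?_
    gcongr
  have h4 : (fun p : Euc n × Euc n =>
      gaussMap K p.1 - gaussMap K p.2 - shapeOperator K x (p.1 - p.2))
      =o[F] (fun p => gaussMap K p.1 - gaussMap K p.2) := by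
    have h := h3.sub (((shapeOperator K x).isBigO_comp _ F).trans_isLittleO h2)
    refine h.congr_left fun p => ?_
    rw [map_sub (shapeOperator K x) (p.1 - p.2), hK.shapeOperator_dReverse hKc hx]
    abel
  -- The error is small relative to the difference of normals, which is therefore bounded by the
  -- shape operator term, hence by `p.1 - p.2`.
  have h5 := h4.right_isBigO_sub
  refine h4.trans_isBigO (h5.trans ?_)
  refine ((shapeOperator K x).isBigO_comp (fun p : Euc n × Euc n => p.1 - p.2) F).congr_left
    fun p => ?_
  rw [sub_sub_cancel]

end Weingarten

/-! ### The area formula with polynomial Jacobian -/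

section Integral

variable {M : Set (Euc n)} {Φ : Euc n × ℝ → Euc n} {ν : Euc n → Euc n}
  {D : Euc n × ℝ → Euc n →L[ℝ] Euc n}

/-- The area formula when the Jacobian is a polynomial in the second variable. -/
theorem volume_real_image_eq_sum (hM : IsCompact M) {T : ℝ} (hT0 : 0 ≤ T)
    (hΦ : ContinuousOn Φ (M ×ˢ Icc 0 T)) (hinj : InjOn Φ (M ×ˢ Ioc 0 T))
    (hν : ∀ x ∈ M, ‖ν x‖ = 1) (hT : ∀ x ∈ M, StrictTangent M (ν x) x)
    (hD : ∀ x ∈ M, ∀ s ∈ Icc 0 T, StrictDeriv M (Icc 0 T) Φ (ν x) (D (x, s)) (x, s))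
    (hDc : ContinuousOn D (M ×ˢ Icc 0 T)) {S : Finset ℕ} {c : Euc n → ℕ → ℝ}
    (hc : ∀ j ∈ S, ContinuousOn (fun x => c x j) M)
    (hdet : ∀ x ∈ M, ∀ s ∈ Ioc 0 T, |(D (x, s)).det| = ∑ j ∈ S, s ^ j * c x j) :
    volume.real (Φ '' (M ×ˢ Ioc 0 T)) =
      ∑ j ∈ S, T ^ (j + 1) / (j + 1) * ∫ x in M, c x j ∂μHE[n - 1] := by
  have hfin := measure_lt_top_of_strictTangent hM hν hT
  have : IsFiniteMeasure ((μHE[n - 1] : Measure (Euc n)).restrict M) :=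
    ⟨by rwa [Measure.restrict_apply_univ]⟩
  have hII : (M ×ˢ Ioc 0 T) ⊆ M ×ˢ Icc 0 T := prod_mono Subset.rfl Ioc_subset_Icc_self
  have hmeas : MeasurableSet (M ×ˢ Ioc 0 T) := hM.measurableSet.prod measurableSet_Ioc
  have hJc : ContinuousOn (fun z => |(D z).det|) (M ×ˢ Icc 0 T) :=
    (ContinuousLinearMap.continuous_det.comp_continuousOn hDc).abs
  rw [Measure.real, volume_image_eq_lintegral hM isCompact_Icc measurableSet_Ioc
    Ioc_subset_Icc_self hΦ hinj hν hT hD hDc,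
    ← integral_eq_lintegral_of_nonneg_ae (Eventually.of_forall fun z => abs_nonneg _)
      ((hJc.mono hII).aestronglyMeasurable hmeas),
    setIntegral_congr_fun (g := fun z => ∑ j ∈ S, c z.1 j * z.2 ^ j) hmeas fun z hz => by
      simp only [← hdet z.1 hz.1 z.2 hz.2, mul_comm (c z.1 _)],
    integral_finsetSum]
  · refine Finset.sum_congr rfl fun j _ => ?_
    rw [setIntegral_prod_mul (fun x => c x j) (fun s : ℝ => s ^ j),
      Measure.restrict_restrict hM.measurableSet, inter_self,
      ← intervalIntegral.integral_of_le hT0, integral_pow]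
    simp [mul_comm]
  · intro j hj
    have h : ContinuousOn (fun z : Euc n × ℝ => c z.1 j * z.2 ^ j) (M ×ˢ Icc 0 T) :=
      ((hc j hj).comp continuousOn_fst fun z hz => hz.1).mul (by fun_prop)
    exact (h.integrableOn_compact (hM.prod isCompact_Icc)).mono_set hII

end Integral

/-! ### Asymptotics on the product filter -/

section ProductFilter

variable {M : Set (Euc n)} {I : Set ℝ} {x : Euc n} {s : ℝ}

theorem tendsto_fst_fst :
    Tendsto (fun p : (Euc n × ℝ) × (Euc n × ℝ) => (p.1.1, p.2.1))
      (𝓝[M ×ˢ I] (x, s) ×ˢ 𝓝[M ×ˢ I] (x, s)) (𝓝[M] x ×ˢ 𝓝[M] x) := by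
  rw [nhdsWithin_prod_eq]
  exact tendsto_fst.prodMap tendsto_fst

theorem tendsto_snd_left :
    Tendsto (fun p : (Euc n × ℝ) × (Euc n × ℝ) => p.1.2)
      (𝓝[M ×ˢ I] (x, s) ×ˢ 𝓝[M ×ˢ I] (x, s)) (𝓝 s) := by
  rw [nhdsWithin_prod_eq]
  exact (tendsto_snd.comp tendsto_fst).mono_right nhdsWithin_le_nhds

theorem tendsto_fst_right :
    Tendsto (fun p : (Euc n × ℝ) × (Euc n × ℝ) => p.2.1)
      (𝓝[M ×ˢ I] (x, s) ×ˢ 𝓝[M ×ˢ I] (x, s)) (𝓝[M] x) := by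
  rw [nhdsWithin_prod_eq]
  exact tendsto_fst.comp tendsto_snd

theorem isBigO_fst_sub (l : Filter ((Euc n × ℝ) × (Euc n × ℝ))) :
    (fun p : (Euc n × ℝ) × (Euc n × ℝ) => p.1.1 - p.2.1) =O[l] fun p => p.1 - p.2 :=
  Asymptotics.isBigO_of_le _ fun p => norm_fst_le (p.1 - p.2)

theorem isBigO_snd_sub (l : Filter ((Euc n × ℝ) × (Euc n × ℝ))) :
    (fun p : (Euc n × ℝ) × (Euc n × ℝ) => p.1.2 - p.2.2) =O[l] fun p => p.1 - p.2 :=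
  Asymptotics.isBigO_of_le _ fun p => norm_snd_le (p.1 - p.2)

theorem isLittleO_smul_of_tendsto_zero {α F G : Type*} [NormedAddCommGroup F] [NormedSpace ℝ F]
    [NormedAddCommGroup G] {l : Filter α} {a : α → ℝ} {f : α → F} {g : α → G}
    (ha : Tendsto a l (𝓝 0)) (hf : f =O[l] g) : (fun p => a p • f p) =o[l] g := by
  have := ((Asymptotics.isLittleO_one_iff ℝ).2 ha).smul_isBigO hf.norm_right
  simpa using this

theorem isLittleO_smul_of_tendsto_zero' {α F G : Type*} [NormedAddCommGroup F] [NormedSpace ℝ F]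
    [NormedAddCommGroup G] {l : Filter α} {a : α → ℝ} {f : α → F} {g : α → G}
    (ha : a =O[l] g) (hf : Tendsto f l (𝓝 0)) : (fun p => a p • f p) =o[l] g := by
  have := ha.norm_right.smul_isLittleO ((Asymptotics.isLittleO_one_iff ℝ).2 hf)
  simpa using this

end ProductFilter

/-! ### The tube around `K` and Steiner's formula for the volume -/

section Tube

variable {K : Set (Euc n)} {x : Euc n}

theorem mem_frontier_of_normal {u : Euc n} (hx : x ∈ K) (hu : IsOuterUnitNormal K x u) :
    x ∈ frontier K := by
  refine ⟨subset_closure hx, fun hint => ?_⟩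
  have hc : ContinuousAt (fun t : ℝ => x + t • u) 0 := by fun_prop
  have h : ∀ᶠ t in 𝓝[>] (0 : ℝ), x + t • u ∈ K :=
    nhdsWithin_le_nhds (hc.eventually (by simpa using mem_interior_iff_mem_nhds.1 hint))
  obtain ⟨t, ht, ht0⟩ := (h.and self_mem_nhdsWithin).exists
  have ht0' : (0 : ℝ) < t := ht0
  have := hu.2 _ ht
  rw [add_sub_cancel_left, inner_smul_right, real_inner_self_eq_norm_sq, hu.1] at this
  linarith

/-- The normal exponential map of the boundary. -/
def tube (K : Set (Euc n)) (z : Euc n × ℝ) : Euc n := z.1 + z.2 • gaussMap K z.1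

theorem IsClassC2Plus.strictTangent (hK : IsClassC2Plus K) (hKc : IsClosed K)
    (hx : x ∈ frontier K) : StrictTangent (frontier K) (gaussMap K x) x :=
  strictTangent_of_normal hK.contDiffOn.continuousOn
    (fun _ hx _ hy => (hK.normal hx).2 _ (hKc.frontier_subset hy)) hx

theorem IsClassC2Plus.strictDeriv_tube (hK : IsClassC2Plus K) (hKc : IsClosed K)
    (hx : x ∈ frontier K) (I : Set ℝ) (s : ℝ) :
    StrictDeriv (frontier K) I (tube K) (gaussMap K x) (1 + s • shapeOperator K x) (x, s) := by
  have h1 := hK.isLittleO_gaussMap hKc hx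
  have h2 : (fun p : Euc n × Euc n => gaussMap K p.1 - gaussMap K p.2)
      =O[𝓝[frontier K] x ×ˢ 𝓝[frontier K] x] (fun p => p.1 - p.2) := by
    have := h1.isBigO.add ((shapeOperator K x).isBigO_comp (fun p : Euc n × Euc n => p.1 - p.2) _)
    simpa using this
  have hO := isBigO_fst_sub (𝓝[frontier K ×ˢ I] (x, s) ×ˢ 𝓝[frontier K ×ˢ I] (x, s))
  have h1' := (h1.comp_tendsto (tendsto_fst_fst (I := I) (s := s))).trans_isBigO hO
  have h2' := (h2.comp_tendsto (tendsto_fst_fst (I := I) (s := s))).trans hO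
  have h3 : Tendsto (fun p : (Euc n × ℝ) × (Euc n × ℝ) => p.1.2 - s)
      (𝓝[frontier K ×ˢ I] (x, s) ×ˢ 𝓝[frontier K ×ˢ I] (x, s)) (𝓝 0) := by
    simpa using (tendsto_snd_left (M := frontier K) (I := I) (x := x) (s := s)).sub_const s
  have h4 : Tendsto (fun p : (Euc n × ℝ) × (Euc n × ℝ) => gaussMap K p.2.1 - gaussMap K x)
      (𝓝[frontier K ×ˢ I] (x, s) ×ˢ 𝓝[frontier K ×ˢ I] (x, s)) (𝓝 0) := by
    have := ((hK.contDiffOn.continuousOn x hx).tendsto.comp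
      (tendsto_fst_right (I := I) (s := s))).sub_const (gaussMap K x)
    simpa using this
  -- The shape operator kills the normal, so the remainder is exactly the sum of these three terms.
  have := ((h1'.const_smul_left s).add (isLittleO_smul_of_tendsto_zero h3 h2')).add
    (isLittleO_smul_of_tendsto_zero' (isBigO_snd_sub _) h4)
  refine this.congr_left fun p => ?_
  change s • (gaussMap K p.1.1 - gaussMap K p.2.1 - shapeOperator K x (p.1.1 - p.2.1)) +
    (p.1.2 - s) • (gaussMap K p.1.1 - gaussMap K p.2.1) +
    (p.1.2 - p.2.2) • (gaussMap K p.2.1 - gaussMap K x) =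
    p.1.1 + p.1.2 • gaussMap K p.1.1 - (p.2.1 + p.2.2 • gaussMap K p.2.1) -
    (p.1.1 - p.2.1 + (p.1.2 - p.2.2) • gaussMap K x +
      s • shapeOperator K x (p.1.1 - p.2.1 + (p.1.2 - p.2.2) • gaussMap K x))
  rw [map_add, map_smul, shapeOperator_gaussMap]
  module

/-- If two normal segments end at the same point, the normal inequalities at their feet combine to
`‖y - x‖ ^ 2 ≤ 0`. -/
theorem IsClassC2Plus.injOn_tube (hK : IsClassC2Plus K) (hKc : IsClosed K) (T : ℝ) :
    InjOn (tube K) (frontier K ×ˢ Ioc 0 T) := by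
  rintro ⟨x, s⟩ ⟨hx, hs, -⟩ ⟨y, r⟩ ⟨hy, hr, -⟩ h
  simp only [tube] at h hx hy hs hr
  have h1 := mul_nonpos_of_nonneg_of_nonpos hs.le
    ((hK.normal hx).2 y (hKc.frontier_subset hy))
  have h2 := mul_nonpos_of_nonneg_of_nonpos hr.le
    ((hK.normal hy).2 x (hKc.frontier_subset hx))
  rw [← real_inner_smul_left] at h1 h2
  have h3 : s • gaussMap K x = y - x + r • gaussMap K y := by
    rw [sub_add_eq_add_sub, ← h]; abel
  have hxy : x = y := by
    rw [h3, inner_add_left] at h1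
    rw [← neg_sub, inner_neg_right] at h2
    have h4 : ⟪y - x, y - x⟫ ≤ 0 := by linarith
    exact (sub_eq_zero.1 (inner_self_eq_zero.1 (le_antisymm h4 real_inner_self_nonneg))).symm
  subst hxy
  have h5 : (s - r) • gaussMap K x = 0 := by
    rw [sub_smul, sub_eq_zero]
    exact add_left_cancel h
  have h6 := (smul_eq_zero.1 h5).resolve_right (hK.gaussMap_ne_zero hx)
  rw [sub_eq_zero.1 h6]

theorem mem_add_smul_closedBall {t : ℝ} (ht : 0 ≤ t) {z : Euc n} :
    z ∈ K + t • Metric.closedBall (0 : Euc n) 1 ↔ ∃ x ∈ K, ‖z - x‖ ≤ t := by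
  rw [smul_unitClosedBall_of_nonneg ht, Set.mem_add]
  constructor
  · rintro ⟨x, hx, b, hb, rfl⟩
    exact ⟨x, hx, by simpa using hb⟩
  · rintro ⟨x, hx, h⟩
    exact ⟨x, hx, z - x, by simpa using h, by abel⟩

/-- The foot is the nearest point of `K`: there `z - x` is an outward normal, and normals are
unique. -/
theorem IsClassC2Plus.exists_eq_tube (hK : IsClassC2Plus K) (hKc : IsClosed K) (hKconv : Convex ℝ K)
    {t : ℝ} (ht : 0 ≤ t) {z : Euc n} (hz : z ∈ K + t • Metric.closedBall (0 : Euc n) 1)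
    (hzK : z ∉ K) : ∃ x ∈ frontier K, ∃ s ∈ Ioc 0 t, z = x + s • gaussMap K x := by
  obtain ⟨k, hk, hkt⟩ := (mem_add_smul_closedBall ht).1 hz
  obtain ⟨x, hx, hxz⟩ := exists_norm_eq_iInf_of_complete_convex ⟨k, hk⟩ hKc.isComplete hKconv z
  have hN := (norm_eq_iInf_iff_real_inner_le_zero hKconv hx).1 hxz
  have hne : z - x ≠ 0 := by
    rw [sub_ne_zero]
    rintro rfl
    exact hzK hx
  have hpos := norm_pos_iff.2 hne
  have hnormal : IsOuterUnitNormal K x (‖z - x‖⁻¹ • (z - x)) := by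
    refine ⟨by rw [norm_smul, norm_inv, norm_norm, inv_mul_cancel₀ hpos.ne'], fun y hy => ?_⟩
    rw [real_inner_smul_left]
    exact mul_nonpos_of_nonneg_of_nonpos (inv_nonneg.2 hpos.le) (hN y hy)
  have hxf := mem_frontier_of_normal hx hnormal
  refine ⟨x, hxf, ‖z - x‖, ⟨hpos, ?_⟩, ?_⟩
  · rw [hxz]
    refine le_trans ?_ hkt
    exact ciInf_le ⟨0, by rintro _ ⟨w, rfl⟩; exact norm_nonneg _⟩ (⟨k, hk⟩ : K)
  · rw [hK.gaussMap_eq hKc hxf hnormal, smul_smul, mul_inv_cancel₀ hpos.ne', one_smul]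
    abel

theorem IsClassC2Plus.image_tube (hK : IsClassC2Plus K) (hKc : IsClosed K) (hKconv : Convex ℝ K)
    {t : ℝ} (ht : 0 ≤ t) : tube K '' (frontier K ×ˢ Ioc 0 t) =
      (K + t • Metric.closedBall (0 : Euc n) 1) \ K := by
  ext z
  constructor
  · rintro ⟨⟨x, s⟩, ⟨hx, hs⟩, rfl⟩
    simp only [tube] at hx hs ⊢
    refine ⟨(mem_add_smul_closedBall ht).2 ⟨x, hKc.frontier_subset hx, ?_⟩, fun h => ?_⟩
    · rw [add_sub_cancel_left, norm_smul, hK.norm_gaussMap hx, mul_one, Real.norm_eq_abs,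
        abs_of_pos hs.1]
      exact hs.2
    · have := (hK.normal hx).2 _ h
      rw [add_sub_cancel_left, inner_smul_right, real_inner_self_eq_norm_sq,
        hK.norm_gaussMap hx] at this
      linarith [hs.1]
  · rintro ⟨hz, hzK⟩
    obtain ⟨x, hx, s, hs, rfl⟩ := hK.exists_eq_tube hKc hKconv ht hz hzK
    exact ⟨(x, s), ⟨hx, hs⟩, rfl⟩

theorem IsClassC2Plus.volume_parallel (hn : 1 ≤ n) (hK : IsClassC2Plus K) (hKc : IsCompact K)
    (hKconv : Convex ℝ K) {t : ℝ} (ht : 0 ≤ t) :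
    volume.real (K + t • Metric.closedBall (0 : Euc n) 1) = volume.real K +
      ∑ j ∈ Finset.range n, t ^ (j + 1) / (j + 1) *
        ∫ x in frontier K, (principalCurvatures K x).esymm j ∂μHE[n - 1] := by
  have hcl := hKc.isClosed
  have hM : IsCompact (frontier K) := hKc.of_isClosed_subset isClosed_frontier hcl.frontier_subset
  have hν := hK.contDiffOn.continuousOn
  have hsub : K ⊆ K + t • Metric.closedBall (0 : Euc n) 1 := fun x hx =>
    (mem_add_smul_closedBall ht).2 ⟨x, hx, by simpa using ht⟩
  have hLc : IsCompact (K + t • Metric.closedBall (0 : Euc n) 1) :=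
    hKc.add ((isCompact_closedBall _ _).smul t)
  have hQ := hK.continuousOn_shapeOperator hcl
  have key := volume_real_image_eq_sum (ν := gaussMap K)
    (D := fun z => 1 + z.2 • shapeOperator K z.1) (S := Finset.range n)
    (c := fun x j => (principalCurvatures K x).esymm j) hM ht
    (by
      have h1 : ContinuousOn (fun z : Euc n × ℝ => gaussMap K z.1) (frontier K ×ˢ Icc 0 t) :=
        hν.comp continuousOn_fst fun z hz => hz.1
      unfold tube
      fun_prop)
    (hK.injOn_tube hcl t) (fun x hx => hK.norm_gaussMap hx)
    (fun x hx => hK.strictTangent hcl hx) (fun x hx s _ => hK.strictDeriv_tube hcl hx _ s)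
    (by
      have h1 : ContinuousOn (fun z : Euc n × ℝ => shapeOperator K z.1) (frontier K ×ˢ Icc 0 t) :=
        hQ.comp continuousOn_fst fun z hz => hz.1
      fun_prop)
    (fun j hj => continuousOn_coeff_det hQ (fun x hx s => hK.det_eq_sum hn hcl hx s)
      (Finset.mem_range.1 hj))
    (fun x hx s hs => by
      rw [abs_of_nonneg (hK.det_nonneg hcl hx hs.1.le), hK.det_eq_sum hn hcl hx s])
  rw [← key, hK.image_tube hcl hKconv ht, measureReal_sdiff hsub hcl.measurableSet
    hLc.measure_ne_top]
  ring

end Tube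

/-! ### Cones over the boundary and the divergence theorem -/

section Cone

variable {L : Set (Euc n)} {ν : Euc n → Euc n} {c y : Euc n}

/-- The cone with apex `c` over a hypersurface. -/
def cone (c : Euc n) (z : Euc n × ℝ) : Euc n := c + z.2 • (z.1 - c)

/-- The Jacobian of `cone c` at `(y, s)`, with respect to the unit normal `u`. -/
def coneDeriv (c y u : Euc n) (s : ℝ) : Euc n →L[ℝ] Euc n :=
  s • 1 + (innerSL ℝ u).smulRight (y - c - s • u)

theorem strictDeriv_cone {M : Set (Euc n)} {u : Euc n} (hu : ‖u‖ = 1) (hT : StrictTangent M u y)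
    (c : Euc n) (I : Set ℝ) (s : ℝ) :
    StrictDeriv M I (cone c) u (coneDeriv c y u s) (y, s) := by
  have hO := isBigO_fst_sub (𝓝[M ×ˢ I] (y, s) ×ˢ 𝓝[M ×ˢ I] (y, s))
  have h1 : Tendsto (fun p : (Euc n × ℝ) × (Euc n × ℝ) => p.1.2 - s)
      (𝓝[M ×ˢ I] (y, s) ×ˢ 𝓝[M ×ˢ I] (y, s)) (𝓝 0) := by
    simpa using (tendsto_snd_left (M := M) (I := I) (x := y) (s := s)).sub_const s
  have h2 : Tendsto (fun p : (Euc n × ℝ) × (Euc n × ℝ) => p.2.1 - y)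
      (𝓝[M ×ˢ I] (y, s) ×ˢ 𝓝[M ×ˢ I] (y, s)) (𝓝 0) := by
    have := ((tendsto_fst_right (M := M) (I := I) (x := y) (s := s)).mono_right
      nhdsWithin_le_nhds).sub_const y
    simpa using this
  have h3 := (Asymptotics.IsLittleO.trans_isBigO
    (hT.comp_tendsto (tendsto_fst_fst (I := I) (s := s))) hO)
  -- `coneDeriv` sends `u` to `y - c` and scales tangent vectors by `s`. Differences of points of
  -- `M` are only nearly tangent; this term is the resulting error.
  have h4 : (fun p : (Euc n × ℝ) × (Euc n × ℝ) => ⟪u, p.1.1 - p.2.1⟫ • (y - c - s • u))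
      =o[𝓝[M ×ˢ I] (y, s) ×ˢ 𝓝[M ×ˢ I] (y, s)] fun p => p.1 - p.2 := by
    refine Asymptotics.IsBigO.trans_isLittleO (Asymptotics.IsBigO.of_bound ‖y - c - s • u‖
      (Eventually.of_forall fun p => ?_)) h3
    rw [norm_smul, mul_comm]
    rfl
  have := ((isLittleO_smul_of_tendsto_zero h1 hO).add
    (isLittleO_smul_of_tendsto_zero' (isBigO_snd_sub _) h2)).sub h4
  refine this.congr_left fun p => ?_
  have huu : ⟪u, u⟫ = 1 := by rw [real_inner_self_eq_norm_sq, hu, one_pow]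
  change (p.1.2 - s) • (p.1.1 - p.2.1) + (p.1.2 - p.2.2) • (p.2.1 - y) -
    ⟪u, p.1.1 - p.2.1⟫ • (y - c - s • u) =
    c + p.1.2 • (p.1.1 - c) - (c + p.2.2 • (p.2.1 - c)) -
    (s • (p.1.1 - p.2.1 + (p.1.2 - p.2.2) • u) +
      ⟪u, p.1.1 - p.2.1 + (p.1.2 - p.2.2) • u⟫ • (y - c - s • u))
  rw [inner_add_right, inner_smul_right, huu]
  module

theorem continuousOn_coneDeriv {M : Set (Euc n)} (hν : ContinuousOn ν M) (c : Euc n) (I : Set ℝ) :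
    ContinuousOn (fun z : Euc n × ℝ => coneDeriv c z.1 (ν z.1) z.2) (M ×ˢ I) := by
  have h1 : ContinuousOn (fun z : Euc n × ℝ => ν z.1) (M ×ˢ I) :=
    hν.comp continuousOn_fst fun z hz => hz.1
  have h2 : Continuous fun q : Euc n × Euc n × ℝ => coneDeriv c q.1 q.2.1 q.2.2 := by
    unfold coneDeriv
    fun_prop
  exact h2.comp_continuousOn
    (f := fun z : Euc n × ℝ => (z.1, ν z.1, z.2)) (continuousOn_fst.prodMk
      (h1.prodMk continuousOn_snd))

theorem det_coneDeriv (hn : 1 ≤ n) {u : Euc n} (hu : ‖u‖ = 1) (c y : Euc n) {s : ℝ} (hs : 0 < s) :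
    (coneDeriv c y u s).det = s ^ (n - 1) * ⟪y - c, u⟫ := by
  have huu : ⟪u, u⟫ = 1 := by rw [real_inner_self_eq_norm_sq, hu, one_pow]
  let f : ℝ →ₗ[ℝ] Euc n := LinearMap.toSpanSingleton ℝ (Euc n) (s⁻¹ • (y - c) - u)
  let g : Euc n →ₗ[ℝ] ℝ := (innerSL ℝ u).toLinearMap
  have h1 : (coneDeriv c y u s).toLinearMap = s • (1 + f ∘ₗ g) := by
    ext1 w
    change s • w + ⟪u, w⟫ • (y - c - s • u) = s • (w + ⟪u, w⟫ • (s⁻¹ • (y - c) - u))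
    rw [smul_add, smul_comm s, smul_sub s, smul_smul s, mul_inv_cancel₀ hs.ne', one_smul]
  have h2 : LinearMap.det (1 + g ∘ₗ f) = s⁻¹ * ⟪y - c, u⟫ := by
    rw [LinearMap.det_ring]
    change 1 + ⟪u, (1 : ℝ) • (s⁻¹ • (y - c) - u)⟫ = _
    rw [one_smul, inner_sub_right, inner_smul_right, huu, real_inner_comm]
    ring
  rw [ContinuousLinearMap.det, h1, LinearMap.det_smul, det_one_add_comp_comm, h2,
    finrank_euclideanSpace_fin]
  obtain ⟨m, rfl⟩ : ∃ m, n = m + 1 := ⟨n - 1, by omega⟩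
  rw [Nat.add_sub_cancel, pow_succ]
  field_simp

theorem inner_sub_pos_of_mem_interior {u : Euc n} (hu : IsOuterUnitNormal L y u)
    (hc : c ∈ interior L) : 0 < ⟪u, y - c⟫ := by
  have hcont : ContinuousAt (fun t : ℝ => c + t • u) 0 := by fun_prop
  have h : ∀ᶠ t in 𝓝[>] (0 : ℝ), c + t • u ∈ L :=
    nhdsWithin_le_nhds (hcont.eventually (by simpa using mem_interior_iff_mem_nhds.1 hc))
  obtain ⟨t, ht, ht0⟩ := (h.and self_mem_nhdsWithin).exists
  have ht0' : (0 : ℝ) < t := ht0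
  have := hu.2 _ ht
  rw [add_sub_right_comm, inner_add_right, inner_smul_right, real_inner_self_eq_norm_sq, hu.1,
    ← neg_sub, inner_neg_right] at this
  linarith

/-- On a ray from `c`, the supporting hyperplane at one boundary point forbids another one farther
out. -/
theorem injOn_cone (hL : IsClosed L) (hN : ∀ y ∈ frontier L, IsOuterUnitNormal L y (ν y))
    (hc : c ∈ interior L) (T : ℝ) : InjOn (cone c) (frontier L ×ˢ Ioc 0 T) := by
  have key : ∀ y ∈ frontier L, ∀ y' ∈ frontier L, ∀ s r : ℝ, 0 < r →
      s • (y - c) = r • (y' - c) → s ≤ r := by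
    intro y hy y' hy' s r hr h
    have h1 := (hN y hy).2 y' (hL.frontier_subset hy')
    have h2 := inner_sub_pos_of_mem_interior (hN y hy) hc
    have h3 : r • (y' - y) = (s - r) • (y - c) := by
      rw [sub_smul, h]; module
    have h4 := mul_nonpos_of_nonneg_of_nonpos hr.le h1
    rw [← real_inner_smul_right, h3, real_inner_smul_right] at h4
    have := nonpos_of_mul_nonpos_left h4 h2
    linarith
  rintro ⟨y, s⟩ ⟨hy, hs, -⟩ ⟨y', r⟩ ⟨hy', hr, -⟩ h
  simp only [cone] at h hy hy' hs hr
  have h1 := add_left_cancel h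
  have hsr : s = r := le_antisymm (key y hy y' hy' s r hr h1) (key y' hy' y hy r s hs h1.symm)
  subst hsr
  have := smul_right_injective (Euc n) hs.ne' h1
  rw [sub_left_injective this]

theorem image_cone (hL : IsCompact L) (hLconv : Convex ℝ L)
    (hN : ∀ y ∈ frontier L, IsOuterUnitNormal L y (ν y)) (hc : c ∈ interior L) :
    cone c '' (frontier L ×ˢ Ioc 0 1) = L \ {c} := by
  ext z
  constructor
  · rintro ⟨⟨y, s⟩, ⟨hy, hs⟩, rfl⟩
    simp only at hy hs
    refine ⟨?_, ?_⟩
    · have := hLconv.add_smul_sub_mem (interior_subset hc) (hL.isClosed.frontier_subset hy)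
        ⟨hs.1.le, hs.2⟩
      exact this
    · simp only [cone, mem_singleton_iff, add_eq_left, smul_eq_zero, not_or]
      refine ⟨hs.1.ne', fun h => ?_⟩
      have := inner_sub_pos_of_mem_interior (hN y hy) hc
      rw [h, inner_zero_right] at this
      exact lt_irrefl _ this
  · rintro ⟨hz, hzc⟩
    have hzc0 : z - c ≠ 0 := sub_ne_zero.2 hzc
    have hpos := norm_pos_iff.2 hzc0
    obtain ⟨R, hR⟩ := hL.isBounded.subset_closedBall c
    -- Parameters of the ray from `c` at or beyond `z` that stay in `L`. The bound from `R` only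
    -- ensures compactness; the largest parameter gives the boundary point.
    let S : Set ℝ := Icc 1 (R / ‖z - c‖) ∩ (fun τ : ℝ => c + τ • (z - c)) ⁻¹' L
    have hScomp : IsCompact S :=
      isCompact_Icc.inter_right (hL.isClosed.preimage (by fun_prop))
    have hmemS : ∀ τ : ℝ, 1 ≤ τ → c + τ • (z - c) ∈ L → τ ∈ S := by
      intro τ hτ h
      refine ⟨⟨hτ, ?_⟩, h⟩
      have := hR h
      rw [mem_closedBall_iff_norm, add_sub_cancel_left, norm_smul, Real.norm_eq_abs,
        abs_of_nonneg (by linarith)] at this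
      rwa [le_div_iff₀ hpos]
    have h1S : (1 : ℝ) ∈ S := hmemS 1 le_rfl (by simpa using hz)
    obtain ⟨τ, hτS, hτ⟩ := hScomp.exists_isGreatest ⟨1, h1S⟩
    have hτ1 : 1 ≤ τ := hτS.1.1
    have hτ0 : 0 < τ := by linarith
    refine ⟨(c + τ • (z - c), τ⁻¹), ⟨⟨subset_closure hτS.2, fun hint => ?_⟩,
      inv_pos.2 hτ0, inv_le_one_of_one_le₀ hτ1⟩, ?_⟩
    · have hcont : ContinuousAt (fun r : ℝ => c + r • (z - c)) τ := by fun_prop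
      have h : ∀ᶠ r in 𝓝[>] τ, c + r • (z - c) ∈ L :=
        nhdsWithin_le_nhds (hcont.eventually (mem_interior_iff_mem_nhds.1 hint))
      obtain ⟨r, hr, hr0⟩ := (h.and self_mem_nhdsWithin).exists
      have hr0' : τ < r := hr0
      have := hτ (hmemS r (by linarith) hr)
      linarith
    · simp only [cone, add_sub_cancel_left, smul_smul, inv_mul_cancel₀ hτ0.ne', one_smul,
        add_sub_cancel]

theorem integral_inner_sub_normal (hn : 1 ≤ n) (hL : IsCompact L) (hLconv : Convex ℝ L)
    (hN : ∀ y ∈ frontier L, IsOuterUnitNormal L y (ν y)) (hν : ContinuousOn ν (frontier L))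
    (hc : c ∈ interior L) :
    ∫ y in frontier L, ⟪y - c, ν y⟫ ∂μHE[n - 1] = n * volume.real L := by
  have hM : IsCompact (frontier L) :=
    hL.of_isClosed_subset isClosed_frontier hL.isClosed.frontier_subset
  have hT : ∀ y ∈ frontier L, StrictTangent (frontier L) (ν y) y := fun y hy =>
    strictTangent_of_normal hν
      (fun x hx y hy => (hN x hx).2 y (hL.isClosed.frontier_subset hy)) hy
  have hν1 : ∀ y ∈ frontier L, ‖ν y‖ = 1 := fun y hy => (hN y hy).1
  have key := volume_real_image_eq_sum (D := fun z => coneDeriv c z.1 (ν z.1) z.2)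
    -- The Jacobian is a single monomial in `s`, and its integral over `(0, 1]` supplies the factor
    -- `1 / n`.
    (S := {n - 1}) (c := fun y _ => ⟪y - c, ν y⟫) (Φ := cone c) hM zero_le_one
    (by unfold cone; fun_prop) (injOn_cone hL.isClosed hN hc 1) hν1 hT
    (fun y hy s _ => strictDeriv_cone (hν1 y hy) (hT y hy) c _ s)
    (continuousOn_coneDeriv hν c _)
    (fun j hj => by fun_prop)
    (fun y hy s hs => by
      rw [det_coneDeriv hn (hν1 y hy) c y hs.1, Finset.sum_singleton, abs_of_nonneg]
      refine mul_nonneg (pow_nonneg hs.1.le _) ?_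
      rw [real_inner_comm]
      exact (inner_sub_pos_of_mem_interior (hN y hy) hc).le)
  rw [image_cone hL hLconv hN hc, Finset.sum_singleton] at key
  have hnull : volume.real ({c} : Set (Euc n)) = 0 := by
    have : Nonempty (Fin n) := ⟨⟨0, hn⟩⟩
    simp [Measure.real]
  rw [measureReal_sdiff_null hnull isCompact_singleton.measure_ne_top, one_pow, Nat.cast_sub hn, Nat.cast_one, sub_add_cancel] at key
  have hn0 : (n : ℝ) ≠ 0 := by positivity
  rw [key]
  field_simp

/-- The divergence theorem for the position field on a convex body. -/
theorem integral_inner_normal (hn : 1 ≤ n) (hL : IsCompact L) (hLconv : Convex ℝ L)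
    (hLint : (interior L).Nonempty)
    (hN : ∀ y ∈ frontier L, IsOuterUnitNormal L y (ν y)) (hν : ContinuousOn ν (frontier L)) :
    ∫ y in frontier L, ⟪y, ν y⟫ ∂μHE[n - 1] = n * volume.real L := by
  obtain ⟨c, hc⟩ := hLint
  have hM : IsCompact (frontier L) :=
    hL.of_isClosed_subset isClosed_frontier hL.isClosed.frontier_subset
  have hfin : μHE[n - 1] (frontier L) < ∞ :=
    measure_lt_top_of_strictTangent hM (fun y hy => (hN y hy).1) fun y hy =>
      strictTangent_of_normal hν
        (fun x hx y hy => (hN x hx).2 y (hL.isClosed.frontier_subset hy)) hy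
  have : IsFiniteMeasure ((μHE[n - 1] : Measure (Euc n)).restrict (frontier L)) :=
    ⟨by rwa [Measure.restrict_apply_univ]⟩
  have hint : ∀ f : Euc n → ℝ, ContinuousOn f (frontier L) →
      Integrable f ((μHE[n - 1] : Measure (Euc n)).restrict (frontier L)) := by
    intro f hf
    have h := hf.integrableOn_compact (μ := (μHE[n - 1] : Measure (Euc n)).restrict (frontier L)) hM
    rwa [IntegrableOn, Measure.restrict_restrict hM.measurableSet, inter_self] at h
  -- Comparing the apexes `c` and `r c`, with `r` slightly above `1`, forces `∫ ⟪c, ν⟫ = 0`.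
  have hsplit : ∀ r : ℝ, r • c ∈ interior L →
      ∫ y in frontier L, ⟪y, ν y⟫ ∂μHE[n - 1] - r * ∫ y in frontier L, ⟪c, ν y⟫ ∂μHE[n - 1] =
        n * volume.real L := by
    intro r hr
    rw [← integral_inner_sub_normal hn hL hLconv hN hν hr, ← integral_const_mul,
      ← integral_sub (hint _ (by fun_prop)) (hint _ (by fun_prop))]
    simp only [inner_sub_left, real_inner_smul_left]
  have h1 := hsplit 1 (by rwa [one_smul])
  have hcont : ContinuousAt (fun r : ℝ => r • c) 1 := by fun_prop
  have h : ∀ᶠ r in 𝓝[>] (1 : ℝ), r • c ∈ interior L :=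
    nhdsWithin_le_nhds (hcont.eventually (by simpa using isOpen_interior.mem_nhds hc))
  obtain ⟨r, hr, hr1⟩ := (h.and self_mem_nhdsWithin).exists
  have hr1' : (1 : ℝ) < r := hr1
  have h2 := hsplit r hr
  have h3 : (r - 1) * ∫ y in frontier L, ⟪c, ν y⟫ ∂μHE[n - 1] = 0 := by linarith
  have h4 := (mul_eq_zero.1 h3).resolve_left (by linarith)
  rw [h4] at h1
  linarith

end Cone

/-! ### The boundary of the parallel body and its Gauss map -/

section Parallel

variable {K : Set (Euc n)} {x y : Euc n} {t : ℝ}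

theorem IsClassC2Plus.normal_parallel (hK : IsClassC2Plus K) (ht : 0 ≤ t)
    (hx : x ∈ frontier K) :
    IsOuterUnitNormal (K + t • Metric.closedBall (0 : Euc n) 1) (x + t • gaussMap K x)
      (gaussMap K x) := by
  refine ⟨hK.norm_gaussMap hx, fun y hy => ?_⟩
  obtain ⟨k, hk, hkt⟩ := (mem_add_smul_closedBall ht).1 hy
  have h1 := (hK.normal hx).2 k hk
  have h2 := real_inner_le_norm (gaussMap K x) (y - k)
  rw [hK.norm_gaussMap hx, one_mul] at h2
  have h3 : y - (x + t • gaussMap K x) = (k - x) + (y - k) - t • gaussMap K x := by abel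
  rw [h3, inner_sub_right, inner_add_right, inner_smul_right, real_inner_self_eq_norm_sq,
    hK.norm_gaussMap hx]
  linarith

/-- The translate of `K` by `t ν x` lies in the parallel body, so a normal there at `x + t ν x` is a
normal of `K` at `x`. Uniqueness is thus inherited from `K`. -/
theorem IsClassC2Plus.gaussMap_parallel (hK : IsClassC2Plus K) (hKc : IsClosed K) (ht : 0 ≤ t)
    (hx : x ∈ frontier K) :
    gaussMap (K + t • Metric.closedBall (0 : Euc n) 1) (x + t • gaussMap K x) = gaussMap K x := by
  refine gaussMap_eq_of_unique (hK.normal_parallel ht hx) fun v hv =>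
    (hK.gaussMap_eq hKc hx ⟨hv.1, fun k hk => ?_⟩).symm
  have h := hv.2 (k + t • gaussMap K x) ((mem_add_smul_closedBall ht).2 ⟨k, hk, by
    rw [add_sub_cancel_left, norm_smul, hK.norm_gaussMap hx, mul_one, Real.norm_eq_abs,
      abs_of_nonneg ht]⟩)
  rwa [add_sub_add_right_eq_sub] at h

theorem IsClassC2Plus.exists_of_mem_frontier_parallel (hK : IsClassC2Plus K) (hKc : IsCompact K)
    (hKconv : Convex ℝ K) (ht : 0 ≤ t)
    (hy : y ∈ frontier (K + t • Metric.closedBall (0 : Euc n) 1)) :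
    ∃ x ∈ frontier K, y = x + t • gaussMap K x := by
  have hLc : IsCompact (K + t • Metric.closedBall (0 : Euc n) 1) :=
    hKc.add ((isCompact_closedBall _ _).smul t)
  have hyL := hLc.isClosed.frontier_subset hy
  have hball : ∀ k ∈ K, ‖y - k‖ < t → False := by
    intro k hk hkt
    refine hy.2 (mem_interior_iff_mem_nhds.2 ?_)
    filter_upwards [Metric.ball_mem_nhds y (sub_pos.2 hkt)] with z hz
    refine (mem_add_smul_closedBall ht).2 ⟨k, hk, ?_⟩
    have h1 := mem_ball_iff_norm.1 hz
    have h2 := norm_add_le (z - y) (y - k)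
    rw [sub_add_sub_cancel] at h2
    linarith
  by_cases hyK : y ∈ K
  · rcases ht.eq_or_lt with rfl | htpos
    · refine ⟨y, ⟨subset_closure hyK, fun hint => hy.2 (interior_mono (fun z hz => ?_) hint)⟩,
        by simp⟩
      exact (mem_add_smul_closedBall le_rfl).2 ⟨z, hz, by simp⟩
    · exact (hball y hyK (by simpa using htpos)).elim
  · obtain ⟨x, hx, s, hs, rfl⟩ := hK.exists_eq_tube hKc.isClosed hKconv ht hyL hyK
    refine ⟨x, hx, ?_⟩
    rcases hs.2.eq_or_lt with h | h
    · rw [h]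
    · refine (hball x (hKc.isClosed.frontier_subset hx) ?_).elim
      rwa [add_sub_cancel_left, norm_smul, hK.norm_gaussMap hx, mul_one, Real.norm_eq_abs,
        abs_of_pos hs.1]

theorem IsClassC2Plus.normal_of_mem_frontier_parallel (hK : IsClassC2Plus K) (hKc : IsCompact K)
    (hKconv : Convex ℝ K) (ht : 0 ≤ t)
    (hy : y ∈ frontier (K + t • Metric.closedBall (0 : Euc n) 1)) :
    IsOuterUnitNormal (K + t • Metric.closedBall (0 : Euc n) 1) y
      (gaussMap (K + t • Metric.closedBall (0 : Euc n) 1) y) := by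
  obtain ⟨x, hx, rfl⟩ := hK.exists_of_mem_frontier_parallel hKc hKconv ht hy
  rw [hK.gaussMap_parallel hKc.isClosed ht hx]
  exact hK.normal_parallel ht hx

/-- The Gauss map of a convex set is monotone, so moving along normals does not decrease distances.
-/
theorem IsClassC2Plus.norm_sub_le_parallel (hK : IsClassC2Plus K) (hKc : IsClosed K) (ht : 0 ≤ t)
    (hx : x ∈ frontier K) (hy : y ∈ frontier K) :
    ‖x - y‖ ≤ ‖x + t • gaussMap K x - (y + t • gaussMap K y)‖ := by
  have h1 := (hK.normal hx).2 y (hKc.frontier_subset hy)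
  have h2 := (hK.normal hy).2 x (hKc.frontier_subset hx)
  have h3 : 0 ≤ ⟪gaussMap K x - gaussMap K y, x - y⟫ := by
    rw [inner_sub_left]
    rw [← neg_sub, inner_neg_right] at h1
    linarith
  have h4 : ⟪x + t • gaussMap K x - (y + t • gaussMap K y), x - y⟫ =
      ‖x - y‖ ^ 2 + t * ⟪gaussMap K x - gaussMap K y, x - y⟫ := by
    rw [← real_inner_self_eq_norm_sq, ← real_inner_smul_left, ← inner_add_left]
    congr 1
    module
  have h5 := real_inner_le_norm (x + t • gaussMap K x - (y + t • gaussMap K y)) (x - y)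
  rw [h4] at h5
  by_contra! hlt
  have h6 := norm_nonneg (x + t • gaussMap K x - (y + t • gaussMap K y))
  nlinarith [mul_nonneg ht h3]

theorem IsClassC2Plus.continuousOn_gaussMap_parallel (hK : IsClassC2Plus K) (hKc : IsCompact K)
    (hKconv : Convex ℝ K) (ht : 0 ≤ t) :
    ContinuousOn (gaussMap (K + t • Metric.closedBall (0 : Euc n) 1))
      (frontier (K + t • Metric.closedBall (0 : Euc n) 1)) := by
  set L := K + t • Metric.closedBall (0 : Euc n) 1 with hL
  -- The foot map back to `frontier K`; the Gauss map of `L` is that of `K` composed with it.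
  let ρ : Euc n → Euc n := fun y => y - t • gaussMap L y
  have hρ : ∀ x ∈ frontier K, ρ (x + t • gaussMap K x) = x := fun x hx => by
    simp only [ρ]
    rw [hL, hK.gaussMap_parallel hKc.isClosed ht hx, add_sub_cancel_right]
  have hρL : LipschitzOnWith 1 ρ (frontier L) := by
    refine LipschitzOnWith.of_dist_le_mul fun y hy y' hy' => ?_
    obtain ⟨x, hx, rfl⟩ := hK.exists_of_mem_frontier_parallel hKc hKconv ht hy
    obtain ⟨x', hx', rfl⟩ := hK.exists_of_mem_frontier_parallel hKc hKconv ht hy'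
    rw [hρ x hx, hρ x' hx', dist_eq_norm, dist_eq_norm, NNReal.coe_one, one_mul]
    exact hK.norm_sub_le_parallel hKc.isClosed ht hx hx'
  have hmaps : MapsTo ρ (frontier L) (frontier K) := fun y hy => by
    obtain ⟨x, hx, rfl⟩ := hK.exists_of_mem_frontier_parallel hKc hKconv ht hy
    rwa [hρ x hx]
  refine (hK.contDiffOn.continuousOn.comp hρL.continuousOn hmaps).congr fun y hy => ?_
  obtain ⟨x, hx, rfl⟩ := hK.exists_of_mem_frontier_parallel hKc hKconv ht hy
  rw [Function.comp_apply, hρ x hx, hL, hK.gaussMap_parallel hKc.isClosed ht hx]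

/-- `ConvexBody` does not require interior points; they come from the `C²` description at a boundary
point. -/
theorem IsClassC2Plus.interior_nonempty (hn : 1 ≤ n) (hK : IsClassC2Plus K) (hKc : IsCompact K)
    (hne : K.Nonempty) : (interior K).Nonempty := by
  have : Nonempty (Fin n) := ⟨⟨0, hn⟩⟩
  have hfr : (frontier K).Nonempty :=
    nonempty_frontier_iff.2 ⟨hne, fun h => noncompact_univ (Euc n) (h ▸ hKc)⟩
  obtain ⟨x, hx⟩ := hfr
  obtain ⟨g, hg0, hg⟩ := hK.classC2.exists_gradient hKc.isClosed hx
  obtain ⟨t, ht⟩ := (hg (-g) (by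
    rw [inner_neg_right]; linarith [real_inner_self_pos.2 hg0])).exists
  exact ⟨_, ht⟩

theorem affineSurfaceArea_zero (hn : 1 ≤ n) (L : Set (Euc n)) :
    affineSurfaceArea 0 L = ∫ x in frontier L, ⟪x, gaussMap L x⟫ ∂μHE[n - 1] := by
  have hn0 : (n : ℝ) ≠ 0 := by positivity
  have h : (n : ℝ) * (0 - 1) / (n + 0) = -1 := by field_simp; ring
  simp only [affineSurfaceArea, h, zero_div, Real.rpow_zero, Real.rpow_neg_one, one_div, inv_inv]

theorem choose_mul_quermassintegral (hn : 1 ≤ n) {j : ℕ} (hj : j < n) (K : Set (Euc n)) :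
    (n.choose (j + 1) : ℝ) * quermassintegral K (j + 1) =
      (j + 1 : ℝ)⁻¹ * ∫ x in frontier K, (principalCurvatures K x).esymm j ∂μHE[n - 1] := by
  have hc : ((n - 1).choose j : ℝ) ≠ 0 := by
    exact_mod_cast (Nat.choose_pos (by omega)).ne'
  have hn0 : (n : ℝ) ≠ 0 := by positivity
  -- Absorption identity: it reconciles the normalization of `H_j` and the `1 / n` in `W_{j+1}` with
  -- the `1 / (j + 1)` from integrating `s ^ j`.
  have hid : (n : ℝ) * (n - 1).choose j = n.choose (j + 1) * (j + 1) := by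
    obtain ⟨m, rfl⟩ : ∃ m, n = m + 1 := ⟨n - 1, by omega⟩
    exact_mod_cast Nat.add_one_mul_choose_eq m j
  simp only [quermassintegral, normalizedCurvature, integral_const_mul]
  have hj0 : (j + 1 : ℝ) ≠ 0 := by positivity
  generalize ∫ x in frontier K, (principalCurvatures K x).esymm j ∂μHE[n - 1] = a
  field_simp
  linear_combination -a * hid

end Parallel

end

end Steiner

end

theorem corollaryC1 (n : ℕ) (hn : 1 ≤ n) (K : ConvexBody (Steiner.Euc n))
    (hK : Steiner.IsClassC2Plus (K : Set (Steiner.Euc n))) (t : ℝ) (ht : 0 ≤ t) :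
    Steiner.affineSurfaceArea 0 ((K : Set (Steiner.Euc n)) + t • Metric.closedBall 0 1) =
        n * volume.real ((K : Set (Steiner.Euc n)) + t • Metric.closedBall 0 1) ∧
      Steiner.affineSurfaceArea 0 ((K : Set (Steiner.Euc n)) + t • Metric.closedBall 0 1) =
        n * ∑ i ∈ Finset.range (n + 1),
          (n.choose i : ℝ) * Steiner.quermassintegral (K : Set (Steiner.Euc n)) i * t ^ i := by
  have hLc : IsCompact ((K : Set (Steiner.Euc n)) + t • Metric.closedBall 0 1) :=
    K.isCompact.add ((isCompact_closedBall _ _).smul t)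
  have hLconv : Convex ℝ ((K : Set (Steiner.Euc n)) + t • Metric.closedBall 0 1) :=
    K.convex.add ((convex_closedBall _ _).smul t)
  have hLint : (interior ((K : Set (Steiner.Euc n)) + t • Metric.closedBall 0 1)).Nonempty :=
    (hK.interior_nonempty hn K.isCompact K.nonempty).mono (interior_mono fun x hx =>
      (Steiner.mem_add_smul_closedBall ht).2 ⟨x, hx, by simpa using ht⟩)
  have h1 : Steiner.affineSurfaceArea 0 ((K : Set (Steiner.Euc n)) + t • Metric.closedBall 0 1) =
      n * volume.real ((K : Set (Steiner.Euc n)) + t • Metric.closedBall 0 1) := by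
    rw [Steiner.affineSurfaceArea_zero hn]
    exact Steiner.integral_inner_normal hn hLc hLconv hLint
      (fun y hy => hK.normal_of_mem_frontier_parallel K.isCompact K.convex ht hy)
      (hK.continuousOn_gaussMap_parallel K.isCompact K.convex ht)
  refine ⟨h1, ?_⟩
  rw [h1, hK.volume_parallel hn K.isCompact K.convex ht, Finset.sum_range_succ']
  congr 1
  rw [add_comm]
  congr 1
  · refine Finset.sum_congr rfl fun j hj => ?_
    rw [Steiner.choose_mul_quermassintegral hn (Finset.mem_range.1 hj)]
    ring
  · simp [Steiner.quermassintegral]
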